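/- Let $\mathbb{R}^3$ have coordinates $(x,y,z)$, let $E=x\partial_x+y\partial_y$, and consider the bivector field $\pi=(E+x\partial_y)\wedge\partial_z$. Let $\mathfrak{X}^k(\mathbb{R}^3)$ be the space of smooth $k$-vector fields, $[\cdot,\cdot]$ the Schouten–Nijenhuis bracket and $d_\pi=[\pi,\cdot]$. Then $[\pi,\pi]=0$ and $d_\pi\circ d_\pi=0$, and the Poisson cohomology groups $$H^k(\mathbb{R}^3,\pi)=\frac{\ker\big(d_\pi:\mathfrak{X}^k(\mathbb{R}^3)\to\mathfrak{X}^{k+1}(\mathbb{R}^3)\big)}{d_\pi\,\mathfrak{X}^{k-1}(\mathbb{R}^3)}\qquad(\mathfrak{X}^{-1}(\mathbb{R}^3)=0)$$ are as follows. - The Casimir functions (the smooth functions $f$ with $d_\pi f=0$) are exactly the constants; thus $H^0(\mathbb{R}^3,\pi)$ is free of rank one over the Casimir functions, generated by $[1]$. - $x\partial_y$ and $\partial_z$ are cocycles, and $H^1(\mathbb{R}^3,\pi)$ is a free module over the Casimir functions with basis $[x\partial_y],\,[\partial_z]$. - $y\partial_x\wedge\partial_z$ is a cocycle, and $H^2(\mathbb{R}^3,\pi)$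 is a free module over the Casimir functions with basis $[y\partial_x\wedge\partial_z]$. - $H^3(\mathbb{R}^3,\pi)=0$. All the algebraic structure on $H^\bullet(\mathbb{R}^3,\pi)$ other than the module structure over the Casimir functions is trivial: for all cocycles $P\in\mathfrak{X}^p(\mathbb{R}^3)$ and $Q\in\mathfrak{X}^q(\mathbb{R}^3)$, the wedge product $P\wedge Q$ represents the zero class if $p,q\ge 1$, and the Schouten–Nijenhuis bracket $[P,Q]$ represents the zero class for all $p,q\geq 0$. -/

import Mathlib

open scoped TensorProduct ContDiff

noncomputable section

namespace PoissonR3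

/-- Three-dimensional space, with coordinates `x = p 0`, `y = p 1`, `z = p 2`. -/
abbrev R3 : Type := Fin 3 → ℝ

/-- The algebra `C^∞(ℝ³)` of smooth real functions on `ℝ³`. -/
def smoothFunctions : Subalgebra ℝ (R3 → ℝ) where
  carrier := {f | ContDiff ℝ ∞ f}
  mul_mem' {f g} hf hg := by
    rw [Set.mem_ofPred_eq] at hf hg ⊢
    exact hf.mul hg
  add_mem' {f g} hf hg := by
    rw [Set.mem_ofPred_eq] at hf hg ⊢
    exact hf.add hg
  algebraMap_mem' r := by
    rw [Set.mem_ofPred_eq]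
    exact contDiff_const

theorem mem_smoothFunctions {f : R3 → ℝ} : f ∈ smoothFunctions ↔ ContDiff ℝ ∞ f := Iff.rfl

/-- Smooth real functions on `ℝ³`. -/
def Smooth : Type := smoothFunctions

instance : CommRing Smooth := inferInstanceAs (CommRing smoothFunctions)

instance : Algebra ℝ Smooth := inferInstanceAs (Algebra ℝ smoothFunctions)

instance : CoeFun Smooth fun _ => R3 → ℝ := ⟨fun f => f.1⟩

@[ext]
theorem Smooth.ext {f g : Smooth} (h : ∀ p, f p = g p) : f = g := Subtype.ext (funext h)

theorem Smooth.contDiff (f : Smooth) : ContDiff ℝ ∞ f := mem_smoothFunctions.1 f.2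

theorem Smooth.differentiableAt (f : Smooth) (p : R3) : DifferentiableAt ℝ f p :=
  f.contDiff.differentiable (by simp) p

/-- The `i`-th coordinate function. -/
def coord (i : Fin 3) : Smooth :=
  ⟨fun p => p i, mem_smoothFunctions.2 (contDiff_apply ℝ ℝ i)⟩

/-- The partial derivative `∂f/∂xᵢ` of a smooth function. -/
def pderiv (i : Fin 3) : Smooth →ₗ[ℝ] Smooth where
  toFun f := ⟨fun p => fderiv ℝ f.1 p (Pi.single i 1),
    mem_smoothFunctions.2
      ((f.contDiff.fderiv_right (m := ∞) (by simp)).clm_apply contDiff_const)⟩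
  map_add' f g := by
    ext p
    change fderiv ℝ (f.1 + g.1) p (Pi.single i 1) = _
    rw [fderiv_add (f.differentiableAt p) (g.differentiableAt p)]
    rfl
  map_smul' c f := by
    ext p
    change fderiv ℝ (c • f.1) p (Pi.single i 1) = _
    rw [fderiv_const_smul (f.differentiableAt p)]
    rfl

theorem pderiv_mul (i : Fin 3) (f g : Smooth) :
    pderiv i (f * g) = f * pderiv i g + pderiv i f * g := by
  ext p
  have h := congrArg (fun L => L (Pi.single i 1))
    (fderiv_mul (f.differentiableAt p) (g.differentiableAt p))
  change fderiv ℝ (f.1 * g.1) p (Pi.single i 1)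
    = f.1 p * fderiv ℝ g.1 p (Pi.single i 1)
      + fderiv ℝ f.1 p (Pi.single i 1) * g.1 p
  simp only [add_apply, smul_apply, smul_eq_mul] at h
  rw [h]
  ring

/-! ### Multivector fields -/

/-- Multivector fields on `ℝ³` (of all degrees together): linear combinations of exterior
products of constant vector fields with smooth coefficients. The product of this ring is the wedge product, and `f • P` is
the multiplication by a smooth function `f`. -/
abbrev MultiVec : Type := Smooth ⊗[ℝ] ExteriorAlgebra ℝ R3

/-- A smooth function, seen as a multivector field of degree `0`. -/
def ofFun (f : Smooth) : MultiVec := f ⊗ₜ[ℝ] 1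

/-- The coordinate vector field `∂ᵢ`. -/
def del (i : Fin 3) : MultiVec := 1 ⊗ₜ[ℝ] ExteriorAlgebra.ι ℝ (Pi.single i 1 : R3)

/-- The multivector fields of degree `k`. -/
def multiVec (k : ℕ) : Submodule Smooth MultiVec :=
  (⋀[ℝ]^k R3 : Submodule ℝ (ExteriorAlgebra ℝ R3)).baseChange Smooth

/-- The coefficientwise partial derivative `∂P/∂xᵢ` of a multivector field. -/
def coeffDeriv (i : Fin 3) : MultiVec →ₗ[ℝ] MultiVec :=
  (pderiv i).rTensor (ExteriorAlgebra ℝ R3)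

/-- Left contraction with `dxᵢ`: the left derivative with respect to the odd variable `∂ᵢ`. -/
def contractL (i : Fin 3) : MultiVec →ₗ[Smooth] MultiVec :=
  (CliffordAlgebra.contractLeft (Q := (0 : QuadraticForm ℝ R3))
    (LinearMap.proj i : Module.Dual ℝ R3)).baseChange Smooth

/-- Right contraction with `dxᵢ`: the right derivative with respect to the odd variable `∂ᵢ`. -/
def contractR (i : Fin 3) : MultiVec →ₗ[Smooth] MultiVec :=
  ((CliffordAlgebra.contractRight (Q := (0 : QuadraticForm ℝ R3))).flip
    (LinearMap.proj i : Module.Dual ℝ R3)).baseChange Smooth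

/-- The Schouten–Nijenhuis bracket, in coordinates:
`[P, Q] = ∑ᵢ (∂ᴿP/∂ζᵢ) ∧ (∂Q/∂xᵢ) - (∂P/∂xᵢ) ∧ (∂ᴸQ/∂ζᵢ)`, where `ζᵢ = ∂ᵢ` are odd variables and
`∂ᴿ`, `∂ᴸ` are right and left derivatives. For homogeneous `P`, `Q` of degrees `a`, `b` this is
`∑ᵢ (∂ᴿP/∂ζᵢ) ∧ (∂Q/∂xᵢ) - (-1)^((a-1)(b-1)) (∂ᴿQ/∂ζᵢ) ∧ (∂P/∂xᵢ)`. It extends the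
Lie bracket of vector fields and satisfies `[X, f] = X(f)`. -/
def schouten (P Q : MultiVec) : MultiVec :=
  ∑ i : Fin 3, (contractR i P * coeffDeriv i Q - coeffDeriv i P * contractL i Q)

theorem coeffDeriv_smul (i : Fin 3) (f : Smooth) (P : MultiVec) :
    coeffDeriv i (f • P) = f • coeffDeriv i P + pderiv i f • P := by
  induction P using TensorProduct.induction_on with
  | zero => simp
  | tmul g a =>
    simp only [TensorProduct.smul_tmul', coeffDeriv, LinearMap.rTensor_tmul, smul_eq_mul,
      pderiv_mul, TensorProduct.add_tmul]
  | add P Q hP hQ =>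
    simp only [smul_add, map_add, hP, hQ]
    abel

theorem ofFun_mul (f : Smooth) (P : MultiVec) : ofFun f * P = f • P := by
  induction P using TensorProduct.induction_on with
  | zero => simp
  | tmul g a => simp [ofFun, TensorProduct.smul_tmul']
  | add P Q hP hQ => rw [mul_add, hP, hQ, smul_add]

theorem schouten_add (P Q R : MultiVec) :
    schouten P (Q + R) = schouten P Q + schouten P R := by
  simp only [schouten, map_add, mul_add, ← Finset.sum_add_distrib]
  refine Finset.sum_congr rfl fun i _ => ?_
  abel

theorem schouten_ofFun (P : MultiVec) (f : Smooth) :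
    schouten P (ofFun f) = ∑ i : Fin 3, contractR i P * ofFun (pderiv i f) := by
  refine Finset.sum_congr rfl fun i _ => ?_
  simp [ofFun, contractL, coeffDeriv]

theorem schouten_smul (P : MultiVec) (f : Smooth) (Q : MultiVec) :
    schouten P (f • Q) = schouten P (ofFun f) * Q + f • schouten P Q := by
  rw [schouten_ofFun, schouten, schouten, Finset.sum_mul, Finset.smul_sum,
    ← Finset.sum_add_distrib]
  refine Finset.sum_congr rfl fun i _ => ?_
  rw [coeffDeriv_smul, map_smul, mul_assoc, ofFun_mul, mul_add, mul_smul_comm, mul_smul_comm,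
    mul_smul_comm, smul_sub]
  abel

/-! ### Poisson cohomology -/

/-- The Casimir functions of a bivector field `π`: the functions `f` with `[π, f] = 0`. -/
def casimirs (π : MultiVec) : Subalgebra ℝ Smooth where
  carrier := {f | schouten π (ofFun f) = 0}
  mul_mem' {f g} hf hg := by
    have h : ofFun (f * g) = f • ofFun g := by simp [ofFun, TensorProduct.smul_tmul']
    simp only [Set.mem_ofPred_eq] at hf hg ⊢
    rw [h, schouten_smul, hf, hg, zero_mul, smul_zero, add_zero]
  add_mem' {f g} hf hg := by
    have h : ofFun (f + g) = ofFun f + ofFun g := TensorProduct.add_tmul _ _ _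
    simp only [Set.mem_ofPred_eq] at hf hg ⊢
    rw [h, schouten_add, hf, hg, add_zero]
  algebraMap_mem' r := by
    have h : ∀ i, pderiv i (algebraMap ℝ Smooth r) = 0 := by
      intro i
      ext p
      change fderiv ℝ (fun _ : R3 => r) p (Pi.single i 1) = 0
      simp
    change schouten π (ofFun (algebraMap ℝ Smooth r)) = 0
    rw [schouten_ofFun]
    simp only [h, ofFun, TensorProduct.zero_tmul, mul_zero, Finset.sum_const_zero]

/-- The Poisson differential `d_π = [π, ·]`; it is linear over the Casimir functions. -/
def poissonDiff (π : MultiVec) : MultiVec →ₗ[casimirs π] MultiVec where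
  toFun P := schouten π P
  map_add' P Q := schouten_add π P Q
  map_smul' f P := by
    have h : schouten π (ofFun (f : Smooth)) = 0 := f.2
    have := schouten_smul π (f : Smooth) P
    rwa [h, zero_mul, zero_add] at this

/-- Poisson cocycles of degree `k`. -/
def cocycles (π : MultiVec) (k : ℕ) : Submodule (casimirs π) MultiVec :=
  (multiVec k).restrictScalars (casimirs π) ⊓ LinearMap.ker (poissonDiff π)

/-- Poisson coboundaries of degree `k`. -/
def coboundaries (π : MultiVec) : ℕ → Submodule (casimirs π) MultiVec
  | 0 => ⊥
  | k + 1 => ((multiVec k).restrictScalars (casimirs π)).map (poissonDiff π)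

/-- The `k`-th Poisson cohomology group `H^k(ℝ³, π)`, a module over the Casimir functions. -/
abbrev PoissonCohomology (π : MultiVec) (k : ℕ) : Type :=
  cocycles π k ⧸ (coboundaries π k).submoduleOf (cocycles π k)

/-- The cohomology class of a Poisson cocycle of degree `k`. -/
def cohClass (π : MultiVec) (k : ℕ) (P : MultiVec) (hP : P ∈ cocycles π k) :
    PoissonCohomology π k :=
  Submodule.Quotient.mk ⟨P, hP⟩

/-! ### The Poisson structure of semi open book type -/

/-- The vector field `E = x ∂_x + y ∂_y`. -/
def eulerField : MultiVec := coord 0 • del 0 + coord 1 • del 1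

/-- The bivector field `π = (E + x ∂_y) ∧ ∂_z`. -/
def semiOpenBook : MultiVec := (eulerField + coord 0 • del 1) * del 2

end PoissonR3

end

noncomputable section

namespace PoissonR3

open MeasureTheory Filter Topology

/-! Write `π = V ∧ ∂_z` with `V = x ∂_x + (x + y) ∂_y`. In coordinates `d_π` is built from three
operations: `∂/∂z`, multiplication by the pair `(x, x + y)`, and the derivative along `V`
(`schouten_semiOpenBook_ofFun`, `schouten_semiOpenBook_mv1`, `schouten_semiOpenBook_mv2`). Every
smooth function is a `z`-derivative (`exists_pderiv_two`), and the Koszul complex of `(x, x + y)` is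
exact in degree one (`exists_of_koszul`). Together these let a coboundary absorb the dependence of a
cocycle on `z`, up to an explicit affine term.

The remaining planar problem is governed by `V`. All orbits of `-V` converge to the axis `x = y =
0`, so `V h = f` is solved by integrating `f` along the flow of `-V` whenever `f` vanishes on the
axis (`exists_lieV_eq`), and a `V`-invariant function depends on `z` only. What survives is
finite-dimensional linear algebra at the origin. Planar fields commuting with `V` are spanned by `V`
and `x ∂_y`, and `V = d_π z` is exact; a constant is not a `V`-derivative, which leaves `∂_z`; the
image of `V - 1` on linear functions is spanned by `x`, which leaves `y ∂_x ∧ ∂_z`. The results are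
`exists_of_cocycle_one`, `exists_of_cocycle_two` and `exists_of_degree_three`.

For the algebraic structure, Leibniz and Jacobi identities reduce everything to these
representatives. The nonzero products and brackets among them in degree at most two are exact, since
`x ∂_y ∧ ∂_z = d_π (y ∂_y)` and `[x ∂_y, y ∂_x ∧ ∂_z] = d_π (y ∂_x)`; from degree three on every
multivector field is a coboundary. -/

/-! ### Differentiation under the integral sign -/

theorem integrable_mul_comp {μ : Measure ℝ} {M : ℝ → R3 →L[ℝ] R3} (hM : Continuous M) {C : ℝ}
    (hC : ∀ᵐ t ∂μ, ‖M t‖ ≤ C) {w : ℝ → ℝ} (hw : Integrable w μ) {f : R3 → ℝ}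
    (hf : Continuous f) (p : R3) : Integrable (fun t => w t * f (M t p)) μ := by
  obtain ⟨K, hK⟩ := (isCompact_closedBall (0 : R3) (C * ‖p‖)).exists_bound_of_continuousOn
    hf.continuousOn
  refine hw.mul_bdd (c := K) ?_ ?_
  · exact (hf.comp (hM.clm_apply continuous_const)).aestronglyMeasurable
  · filter_upwards [hC] with t ht
    refine hK _ ?_
    rw [mem_closedBall_zero_iff]
    exact ((M t).le_opNorm p).trans (by gcongr)

theorem hasFDerivAt_integral_comp {μ : Measure ℝ} {M : ℝ → R3 →L[ℝ] R3} (hM : Continuous M) {C : ℝ}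
    (hC : ∀ᵐ t ∂μ, ‖M t‖ ≤ C) {w : ℝ → ℝ} (hw : Integrable w μ) {f : R3 → ℝ}
    (hf : ContDiff ℝ ∞ f) (p : R3) :
    Integrable (fun t => w t • (fderiv ℝ f (M t p)).comp (M t)) μ ∧
    HasFDerivAt (fun p => ∫ t, w t * f (M t p) ∂μ)
      (∫ t, w t • (fderiv ℝ f (M t p)).comp (M t) ∂μ) p := by
  have hf' : Continuous (fderiv ℝ f) := hf.continuous_fderiv (by simp)
  have hd : Differentiable ℝ f := hf.differentiable (by simp)
  -- This ball contains `M t q` for almost every `t` and all `q` within distance one of `p`. The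
  -- absolute value matters because `C` may be negative when `μ = 0`.
  obtain ⟨K, hK⟩ := (isCompact_closedBall (0 : R3) (|C| * (‖p‖ + 1))).exists_bound_of_continuousOn
    hf'.continuousOn
  have hmeas : AEStronglyMeasurable (fun t => w t • (fderiv ℝ f (M t p)).comp (M t)) μ := by
    refine hw.aestronglyMeasurable.smul (Continuous.aestronglyMeasurable ?_)
    exact (hf'.comp (hM.clm_apply continuous_const)).clm_comp hM
  have hbound : ∀ᵐ t ∂μ, ∀ q ∈ Metric.ball p 1,
      ‖w t • (fderiv ℝ f (M t q)).comp (M t)‖ ≤ ‖w t‖ * (K * |C|) := by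
    filter_upwards [hC] with t ht q hq
    have hq' : ‖q‖ ≤ ‖p‖ + 1 := by
      have := norm_le_norm_add_norm_sub p q
      have h2 : ‖q - p‖ < 1 := by simpa [dist_eq_norm] using hq
      rw [norm_sub_rev] at h2
      linarith [norm_sub_norm_le q p, norm_sub_rev p q]
    have ht' : ‖M t‖ ≤ |C| := ht.trans (le_abs_self C)
    have h1 : ‖fderiv ℝ f (M t q)‖ ≤ K := by
      refine hK _ ?_
      rw [mem_closedBall_zero_iff]
      exact ((M t).le_opNorm q).trans (by gcongr)
    rw [norm_smul]
    gcongr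
    refine (ContinuousLinearMap.opNorm_comp_le _ _).trans ?_
    exact mul_le_mul h1 ht' (norm_nonneg _) ((norm_nonneg _).trans h1)
  have hbi : Integrable (fun t => ‖w t‖ * (K * |C|)) μ := hw.norm.mul_const _
  refine ⟨hbi.mono' hmeas (hbound.mono fun t ht => ht p (Metric.mem_ball_self one_pos)), ?_⟩
  refine hasFDerivAt_integral_of_dominated_of_fderiv_le
    (F' := fun p t => w t • (fderiv ℝ f (M t p)).comp (M t)) (Metric.ball_mem_nhds p one_pos)
    (Eventually.of_forall fun q => ?_) (integrable_mul_comp hM hC hw hf.continuous p) hmeas hbound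
    hbi (Eventually.of_forall fun t q _ => ?_)
  · exact (integrable_mul_comp hM hC hw hf.continuous q).aestronglyMeasurable
  · exact ((hd (M t q)).hasFDerivAt.comp q (M t).hasFDerivAt).const_mul (w t)

theorem eq_sum_single (v : R3) : v = ∑ j : Fin 3, v j • (Pi.single j 1 : R3) := by
  ext i
  simp [Finset.sum_apply, Pi.single_apply]

/-- Smoothness of the weighted integral of a smooth function along a bounded family of linear
substitutions. -/
theorem contDiff_integral_comp {μ : Measure ℝ} {M : ℝ → R3 →L[ℝ] R3} (hM : Continuous M) {C : ℝ}
    (hC : ∀ᵐ t ∂μ, ‖M t‖ ≤ C) {w : ℝ → ℝ} (hw : Integrable w μ) {f : R3 → ℝ}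
    (hf : ContDiff ℝ ∞ f) : ContDiff ℝ ∞ (fun p => ∫ t, w t * f (M t p) ∂μ) := by
  rw [contDiff_infty]
  intro n
  induction n generalizing w f with
  | zero =>
    rw [Nat.cast_zero, contDiff_zero]
    exact Differentiable.continuous (𝕜 := ℝ)
      fun p => (hasFDerivAt_integral_comp hM hC hw hf p).2.differentiableAt
  | succ n ih =>
    rw [Nat.cast_succ, contDiff_succ_iff_fderiv_apply]
    refine ⟨fun p => (hasFDerivAt_integral_comp hM hC hw hf p).2.differentiableAt, by simp,
      fun v => ?_⟩
    have hw' : ∀ j, Integrable (fun t => w t * M t v j) μ := by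
      intro j
      refine hw.mul_bdd (c := C * ‖v‖) ?_ ?_
      · exact ((continuous_apply j).comp (hM.clm_apply continuous_const)).aestronglyMeasurable
      · filter_upwards [hC] with t ht
        exact (norm_le_pi_norm _ j).trans (((M t).le_opNorm v).trans (by gcongr))
    have hd : ∀ j, ContDiff ℝ ∞ (fun p => fderiv ℝ f p (Pi.single j 1)) := fun j =>
      (hf.fderiv_right (m := ∞) (by simp)).clm_apply contDiff_const
    -- A directional derivative is a sum of integrals of the same shape, with weights `w t * M t v
    -- j` and integrands `∂f/∂xⱼ`. This is why the induction generalizes over both `w` and `f`.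
    have key : (fun p => fderiv ℝ (fun p => ∫ t, w t * f (M t p) ∂μ) p v)
        = fun p => ∑ j : Fin 3,
          ∫ t, (w t * M t v j) * fderiv ℝ f (M t p) (Pi.single j 1) ∂μ := by
      ext p
      obtain ⟨hi, hh⟩ := hasFDerivAt_integral_comp hM hC hw hf p
      rw [hh.fderiv, ContinuousLinearMap.integral_apply hi,
        ← integral_finsetSum _ fun j _ => integrable_mul_comp hM hC (hw' j) (hd j).continuous p]
      congr 1
      ext t
      simp only [smul_apply, ContinuousLinearMap.comp_apply, smul_eq_mul]
      conv_lhs => rw [eq_sum_single (M t v)]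
      simp only [map_sum, map_smul, smul_eq_mul, Finset.mul_sum, mul_assoc]
    rw [key]
    exact ContDiff.sum fun j _ => ih (hw' j) (hd j)

/-! ### Pointwise rules and partial derivatives -/

namespace Smooth

@[simp] theorem add_apply (f g : Smooth) (p : R3) : (f + g) p = f p + g p := rfl
@[simp] theorem sub_apply (f g : Smooth) (p : R3) : (f - g) p = f p - g p := rfl
@[simp] theorem neg_apply (f : Smooth) (p : R3) : (-f) p = -f p := rfl
@[simp] theorem mul_apply (f g : Smooth) (p : R3) : (f * g) p = f p * g p := rfl
@[simp] theorem zero_apply (p : R3) : (0 : Smooth) p = 0 := rfl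
@[simp] theorem one_apply (p : R3) : (1 : Smooth) p = 1 := rfl
@[simp] theorem algebraMap_apply (r : ℝ) (p : R3) : (algebraMap ℝ Smooth r) p = r := rfl

end Smooth

@[simp] theorem coord_apply (i : Fin 3) (p : R3) : coord i p = p i := rfl

theorem pderiv_apply (i : Fin 3) (f : Smooth) (p : R3) :
    pderiv i f p = fderiv ℝ f.1 p (Pi.single i 1) := rfl

theorem pderiv_coord (i j : Fin 3) : pderiv i (coord j) = if i = j then 1 else 0 := by
  ext p
  have : fderiv ℝ (fun p : R3 => p j) p = ContinuousLinearMap.proj j :=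
    (ContinuousLinearMap.proj (R := ℝ) (φ := fun _ : Fin 3 => ℝ) j).fderiv
  change fderiv ℝ (fun p : R3 => p j) p (Pi.single i 1) = _
  rw [this]
  by_cases h : i = j
  · subst h; simp
  · simp [h, Ne.symm h]

@[simp] theorem pderiv_algebraMap (i : Fin 3) (r : ℝ) : pderiv i (algebraMap ℝ Smooth r) = 0 := by
  ext p
  change fderiv ℝ (fun _ : R3 => r) p (Pi.single i 1) = 0
  simp

@[simp] theorem pderiv_one (i : Fin 3) : pderiv i 1 = 0 := by
  simpa using pderiv_algebraMap i 1

theorem fderiv_eq_sum (f : Smooth) (p v : R3) :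
    fderiv ℝ f.1 p v = ∑ i : Fin 3, v i * pderiv i f p := by
  conv_lhs => rw [eq_sum_single v]
  simp only [map_sum, map_smul, smul_eq_mul, pderiv_apply]

theorem pderiv_comm (i j : Fin 3) (f : Smooth) :
    pderiv i (pderiv j f) = pderiv j (pderiv i f) := by
  ext p
  have key : ∀ i j : Fin 3, pderiv i (pderiv j f) p
      = fderiv ℝ (fderiv ℝ f.1) p (Pi.single i 1) (Pi.single j 1) := by
    intro i j
    have hd : DifferentiableAt ℝ (fderiv ℝ f.1) p :=
      (f.contDiff.fderiv_right (m := ∞) (by simp)).differentiable (by simp) p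
    change fderiv ℝ (fun q => fderiv ℝ f.1 q (Pi.single j 1)) p (Pi.single i 1) = _
    rw [(hd.hasFDerivAt.clm_apply (hasFDerivAt_const _ _)).fderiv]
    simp
  rw [key, key]
  exact (f.contDiff.contDiffAt.isSymmSndFDerivAt (by
    rw [minSmoothness_of_isRCLikeNormedField]; exact WithTop.coe_le_coe.2 le_top)) _ _

/-! ### Averages, Hadamard's lemma and primitives in `z` -/

/-- The smooth function `p ↦ ∫ w(t) f(M t p) dμ(t)`. -/
def average (μ : Measure ℝ) {M : ℝ → R3 →L[ℝ] R3} (hM : Continuous M) {C : ℝ}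
    (hC : ∀ᵐ t ∂μ, ‖M t‖ ≤ C) {w : ℝ → ℝ} (hw : Integrable w μ) (f : Smooth) : Smooth :=
  ⟨fun p => ∫ t, w t * f (M t p) ∂μ,
    mem_smoothFunctions.2 (contDiff_integral_comp hM hC hw f.contDiff)⟩

theorem average_apply (μ : Measure ℝ) {M : ℝ → R3 →L[ℝ] R3} (hM : Continuous M) {C : ℝ}
    (hC : ∀ᵐ t ∂μ, ‖M t‖ ≤ C) {w : ℝ → ℝ} (hw : Integrable w μ) (f : Smooth) (p : R3) :
    average μ hM hC hw f p = ∫ t, w t * f (M t p) ∂μ := rfl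

theorem norm_add_smul_le (A B : R3 →L[ℝ] R3) :
    ∀ᵐ t ∂(volume.restrict (Set.Ioc (0 : ℝ) 1)), ‖A + t • B‖ ≤ ‖A‖ + ‖B‖ := by
  filter_upwards [ae_restrict_mem measurableSet_Ioc] with t ht
  refine (norm_add_le _ _).trans ?_
  rw [norm_smul, Real.norm_eq_abs, abs_of_pos ht.1]
  nlinarith [norm_nonneg B, ht.2]

theorem exists_smooth_integral (A B : R3 →L[ℝ] R3) (f : Smooth) :
    ∃ g : Smooth, ∀ p, g p = ∫ t in (0 : ℝ)..1, f (A p + t • B p) := by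
  have hM : Continuous fun t : ℝ => A + t • B := by fun_prop
  refine ⟨average _ hM (norm_add_smul_le A B) (w := fun _ => 1) (integrable_const _) f,
    fun p => ?_⟩
  rw [average_apply, intervalIntegral.integral_of_le zero_le_one]
  simp

/-- Hadamard's lemma along the segments from `A p` to `A p + B p`. -/
theorem hadamard (A B : R3 →L[ℝ] R3) (f : Smooth) :
    ∃ g : Fin 3 → Smooth, ∀ p, f (A p + B p) = f (A p) + ∑ i, B p i * g i p := by
  choose g hg using fun i => exists_smooth_integral A B (pderiv i f)
  refine ⟨g, fun p => ?_⟩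
  have hc : ∀ i, Continuous fun t : ℝ => B p i * pderiv i f (A p + t • B p) := fun i =>
    continuous_const.mul ((pderiv i f).contDiff.continuous.comp (by fun_prop))
  have hder : ∀ t : ℝ, HasDerivAt (fun t : ℝ => f (A p + t • B p))
      (∑ i, B p i * pderiv i f (A p + t • B p)) t := by
    intro t
    have h1 : HasDerivAt (fun t : ℝ => A p + t • B p) (B p) t := by
      simpa using ((hasDerivAt_id t).smul_const (B p)).const_add (A p)
    have := (f.differentiableAt (A p + t • B p)).hasFDerivAt.comp_hasDerivAt t h1
    rwa [fderiv_eq_sum] at this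
  have hint := intervalIntegral.integral_eq_sub_of_hasDerivAt (a := 0) (b := 1)
    (fun t _ => hder t) ((continuous_finsetSum _ fun i _ => hc i).intervalIntegrable _ _)
  rw [intervalIntegral.integral_finsetSum fun i _ => (hc i).intervalIntegrable _ _] at hint
  simp only [intervalIntegral.integral_const_mul, ← hg] at hint
  simp only [one_smul, zero_smul, add_zero] at hint
  linarith

/-- The projection of `ℝ³` onto the `i`-th axis. -/
def axisProj (i : Fin 3) : R3 →L[ℝ] R3 :=
  (ContinuousLinearMap.proj (R := ℝ) (φ := fun _ : Fin 3 => ℝ) i).smulRight (Pi.single i 1)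

theorem axisProj_apply (i : Fin 3) (p : R3) (j : Fin 3) :
    axisProj i p j = if j = i then p i else 0 := by
  simp [axisProj, Pi.single_apply]

theorem hadamard_x (f : Smooth) : ∃ g : Smooth, ∀ p : R3, f p = f ![0, p 1, p 2] + p 0 * g p := by
  obtain ⟨g, hg⟩ := hadamard (axisProj 1 + axisProj 2) (axisProj 0) f
  refine ⟨g 0, fun p => ?_⟩
  have h1 : (axisProj 1 + axisProj 2) p = ![0, p 1, p 2] := by
    ext i; fin_cases i <;> simp [axisProj_apply]
  have h2 : ![0, p 1, p 2] + axisProj 0 p = p := by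
    ext i; fin_cases i <;> simp [axisProj_apply]
  simpa [h1, h2, Fin.sum_univ_three, axisProj_apply] using hg p

theorem hadamard_xy (f : Smooth) :
    ∃ g h : Smooth, ∀ p : R3, f p = f ![0, 0, p 2] + p 0 * g p + p 1 * h p := by
  obtain ⟨g, hg⟩ := hadamard (axisProj 2) (axisProj 0 + axisProj 1) f
  refine ⟨g 0, g 1, fun p => ?_⟩
  have h1 : axisProj 2 p = ![0, 0, p 2] := by
    ext i; fin_cases i <;> simp [axisProj_apply]
  have h2 : ![0, 0, p 2] + (axisProj 0 p + axisProj 1 p) = p := by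
    ext i; fin_cases i <;> simp [axisProj_apply]
  simpa [h1, h2, Fin.sum_univ_three, axisProj_apply, add_assoc] using hg p

/-- Every smooth function is a derivative in the direction of `z`. -/
theorem exists_pderiv_two (f : Smooth) : ∃ g : Smooth, pderiv 2 g = f := by
  obtain ⟨G, hG⟩ := exists_smooth_integral (axisProj 0 + axisProj 1) (axisProj 2) f
  refine ⟨coord 2 * G, ?_⟩
  -- The primitive is written as `z` times an average over a segment so that its smoothness is
  -- already known; the substitution `s = z t` recovers the usual integral.
  have hval : ∀ p : R3, (coord 2 * G) p = ∫ s in (0 : ℝ)..p 2, f ![p 0, p 1, s] := by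
    intro p
    have h1 : ∀ t : ℝ, (axisProj 0 + axisProj 1) p + t • axisProj 2 p
        = ![p 0, p 1, p 2 * t] := by
      intro t; ext i; fin_cases i <;> simp [axisProj_apply, mul_comm]
    rw [Smooth.mul_apply, hG, coord_apply]
    simp only [h1]
    have := intervalIntegral.mul_integral_comp_mul_left (a := 0) (b := 1)
      (f := fun s => f ![p 0, p 1, s]) (p 2)
    simpa using this
  ext p
  have hl : HasDerivAt (fun s : ℝ => (coord 2 * G) (p + s • Pi.single 2 1))
      (pderiv 2 (coord 2 * G) p) 0 := by
    have h1 : HasDerivAt (fun s : ℝ => p + s • (Pi.single 2 1 : R3)) (Pi.single 2 1) 0 := by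
      simpa using ((hasDerivAt_id (0 : ℝ)).smul_const (Pi.single 2 1 : R3)).const_add p
    have h2 := ((coord 2 * G).differentiableAt (p + (0 : ℝ) • Pi.single 2 1)).hasFDerivAt
    have := h2.comp_hasDerivAt (0 : ℝ) h1
    rw [zero_smul, add_zero] at this
    exact this
  have hr : HasDerivAt (fun s : ℝ => (coord 2 * G) (p + s • Pi.single 2 1)) (f p) 0 := by
    have h1 : (fun s : ℝ => (coord 2 * G) (p + s • Pi.single 2 1))
        = fun s => (fun u => ∫ v in (0 : ℝ)..u, f ![p 0, p 1, v]) (p 2 + s) := by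
      ext s
      rw [hval]
      simp
    have hc : Continuous fun v : ℝ => f ![p 0, p 1, v] :=
      f.contDiff.continuous.comp (continuous_pi fun i => by
        fin_cases i <;> simp <;> fun_prop)
    have h2 : HasDerivAt (fun u => ∫ v in (0 : ℝ)..u, f ![p 0, p 1, v]) (f ![p 0, p 1, p 2])
        (p 2 + 0) := by
      rw [add_zero]
      exact intervalIntegral.integral_hasDerivAt_right (hc.intervalIntegrable _ _)
        (hc.stronglyMeasurableAtFilter _ _) hc.continuousAt
    rw [h1]
    have h3 := h2.comp_const_add (p 2) 0
    have h4 : ![p 0, p 1, p 2] = p := by ext i; fin_cases i <;> rfl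
    rwa [h4] at h3
  exact hl.unique hr

/-! ### Division by coordinates and the Koszul relation -/

/-- Off the hyperplane one divides by the coordinate; on it, the derivative of the product in
direction `i` is the value of `f`. -/
theorem eq_zero_of_coord_mul {i : Fin 3} {f : Smooth} (h : coord i * f = 0) : f = 0 := by
  ext p
  by_cases hp : p i = 0
  · have h1 := congrArg (fun g => (pderiv i g : Smooth) p) h
    simpa [pderiv_mul, pderiv_coord, hp] using h1
  · have h1 := congrArg (fun g : Smooth => g p) h
    simpa [hp] using h1

theorem coord_mul_cancel {i : Fin 3} {f g : Smooth} (h : coord i * f = coord i * g) : f = g :=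
  sub_eq_zero.1 (eq_zero_of_coord_mul (i := i) (by rw [mul_sub, h, sub_self]))

/-- Exactness of the Koszul complex of `(x, x + y)` in degree one. -/
theorem exists_of_koszul {a b : Smooth} (h : coord 0 * b = (coord 0 + coord 1) * a) :
    ∃ k : Smooth, a = coord 0 * k ∧ b = (coord 0 + coord 1) * k := by
  obtain ⟨k, hk⟩ := hadamard_x a
  have ha : a = coord 0 * k := by
    ext p
    rw [hk p]
    -- On `x = 0` the relation reads `y a = 0`; at `y = 0` its `y`-derivative gives `a = 0`.
    suffices a ![0, p 1, p 2] = 0 by simp [this]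
    by_cases hp : p 1 = 0
    · have h1 := congrArg (fun g => (pderiv 1 g : Smooth) ![0, p 1, p 2]) h
      simpa [pderiv_mul, pderiv_coord, hp] using h1.symm
    · have h1 := congrArg (fun g : Smooth => g ![0, p 1, p 2]) h
      simpa [hp] using h1.symm
  refine ⟨k, ha, coord_mul_cancel (i := 0) ?_⟩
  rw [h, ha]
  ring

/-! ### The vector field `V` and its contracting flow -/

/-- The derivative of functions along the vector field `V = x ∂_x + (x + y) ∂_y`. -/
def lieV (f : Smooth) : Smooth := coord 0 * pderiv 0 f + (coord 0 + coord 1) * pderiv 1 f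

/-- The flow of `-V`, at time `t`. -/
def flow (t : ℝ) : R3 →L[ℝ] R3 :=
  Real.exp (-t) • (axisProj 0 + axisProj 1)
    - (Real.exp (-t) * t) • (ContinuousLinearMap.proj (R := ℝ) (φ := fun _ : Fin 3 => ℝ) 0).smulRight
      (Pi.single 1 1) + axisProj 2

theorem flow_apply (t : ℝ) (p : R3) :
    flow t p = ![Real.exp (-t) * p 0, Real.exp (-t) * (p 1 - t * p 0), p 2] := by
  ext i
  fin_cases i <;> simp [flow, axisProj_apply]
  ring

theorem continuous_flow : Continuous flow := by
  unfold flow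
  fun_prop

theorem flow_zero (p : R3) : flow 0 p = p := by
  rw [flow_apply]
  ext i
  fin_cases i <;> simp

theorem flow_flow (s t : ℝ) (p : R3) : flow t (flow s p) = flow (t + s) p := by
  rw [flow_apply, flow_apply, flow_apply]
  ext i
  fin_cases i
  · simp [Real.exp_add]; ring
  · simp [Real.exp_add]; ring
  · simp

/-- The flow of `-V` is contracting apart from the Jordan block term `t e⁻ᵗ`, which is at most one
because `t + 1 ≤ eᵗ`. The uniform bound is what allows smooth dependence of integrals over all `t >
0`. -/
theorem exists_norm_flow_le :
    ∃ C : ℝ, ∀ᵐ t ∂(volume.restrict (Set.Ioi (0 : ℝ))), ‖flow t‖ ≤ C := by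
  refine ⟨‖axisProj 0 + axisProj 1‖ + ‖(ContinuousLinearMap.proj (R := ℝ)
    (φ := fun _ : Fin 3 => ℝ) 0).smulRight (Pi.single 1 1 : R3)‖ + ‖axisProj 2‖, ?_⟩
  filter_upwards [ae_restrict_mem measurableSet_Ioi] with t ht
  have ht : 0 < t := ht
  have h1 : Real.exp (-t) ≤ 1 := Real.exp_le_one_iff.2 (by linarith)
  have h2 : Real.exp (-t) * t ≤ 1 := by
    have := Real.add_one_le_exp t
    have h3 : Real.exp (-t) * Real.exp t = 1 := by rw [← Real.exp_add]; simp
    nlinarith [Real.exp_pos (-t)]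
  refine (norm_add_le _ _).trans ?_
  gcongr
  refine (norm_sub_le _ _).trans ?_
  rw [norm_smul, norm_smul, Real.norm_of_nonneg (Real.exp_pos _).le,
    Real.norm_of_nonneg (by positivity)]
  gcongr
  · exact mul_le_of_le_one_left (norm_nonneg _) h1
  · exact mul_le_of_le_one_left (norm_nonneg _) h2

theorem hasDerivAt_flow (p : R3) (t : ℝ) :
    HasDerivAt (fun t => flow t p)
      ![-(flow t p 0), -(flow t p 0 + flow t p 1), 0] t := by
  have he : HasDerivAt (fun t : ℝ => Real.exp (-t)) (-Real.exp (-t)) t := by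
    have := (Real.hasDerivAt_exp (-t)).comp t (hasDerivAt_neg t)
    rwa [mul_neg_one] at this
  rw [hasDerivAt_pi]
  intro i
  simp only [flow_apply]
  fin_cases i
  · simpa using he.mul_const (p 0)
  · have h1 : HasDerivAt (fun t : ℝ => p 1 - t * p 0) (-p 0) t := by
      simpa using ((hasDerivAt_id t).mul_const (p 0)).const_sub (p 1)
    have h2 := he.mul h1
    exact h2.congr_deriv (by simp)
  · simpa using hasDerivAt_const t (p 2)

theorem hasDerivAt_comp_flow (f : Smooth) (p : R3) (t : ℝ) :
    HasDerivAt (fun t => f (flow t p)) (-(lieV f (flow t p))) t := by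
  have h := (f.differentiableAt (flow t p)).hasFDerivAt.comp_hasDerivAt t (hasDerivAt_flow p t)
  rw [fderiv_eq_sum] at h
  refine h.congr_deriv ?_
  simp [Fin.sum_univ_three, lieV]
  ring

theorem tendsto_flow (p : R3) : Tendsto (fun t => flow t p) atTop (𝓝 ![0, 0, p 2]) := by
  have h0 : Tendsto (fun t : ℝ => Real.exp (-t)) atTop (𝓝 0) := Real.tendsto_exp_neg_atTop_nhds_zero
  have h1 : Tendsto (fun t : ℝ => t * Real.exp (-t)) atTop (𝓝 0) := by
    simpa using Real.tendsto_pow_mul_exp_neg_atTop_nhds_zero 1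
  rw [tendsto_pi_nhds]
  intro i
  simp only [flow_apply]
  fin_cases i
  · simpa using h0.mul_const (p 0)
  · have := (h0.mul_const (p 1)).sub (h1.mul_const (p 0))
    simp only [zero_mul, sub_zero] at this
    refine this.congr fun t => ?_
    simp
    ring
  · simp

/-- A function invariant under the flow of `V` depends on `z` only. -/
theorem apply_eq_of_lieV_eq_zero {f : Smooth} (h : lieV f = 0) (p : R3) :
    f p = f ![0, 0, p 2] := by
  have hd : ∀ t, HasDerivAt (fun t => f (flow t p)) 0 t := by
    intro t
    simpa [h] using hasDerivAt_comp_flow f p t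
  have hc : ∀ t, f (flow t p) = f p := by
    intro t
    have := is_const_of_deriv_eq_zero (fun t => (hd t).differentiableAt) (fun t => (hd t).deriv) t 0
    simpa [flow_zero] using this
  refine tendsto_nhds_unique (f := fun t => f (flow t p)) (l := atTop) ?_
    ((f.contDiff.continuous.tendsto _).comp (tendsto_flow p))
  simp only [hc]
  exact tendsto_const_nhds

/-- A smooth function vanishing on the axis `x = y = 0` is the derivative along `V` of a smooth
function vanishing on the axis. -/
theorem exists_lieV_eq {f : Smooth} (hf : ∀ z, f ![0, 0, z] = 0) :
    ∃ h : Smooth, lieV h = f ∧ ∀ z, h ![0, 0, z] = 0 := by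
  obtain ⟨f₁, f₂, h12⟩ := hadamard_xy f
  obtain ⟨C, hC⟩ := exists_norm_flow_le
  have hw1 : Integrable (fun t : ℝ => Real.exp (-t)) (volume.restrict (Set.Ioi 0)) :=
    integrableOn_exp_neg_Ioi 0
  have hw2 : Integrable (fun t : ℝ => Real.exp (-t) * t) (volume.restrict (Set.Ioi 0)) := by
    have := Real.GammaIntegral_convergent (s := 2) (by norm_num)
    refine this.congr (ae_of_all _ fun t => ?_)
    norm_num
  -- This is `∫₀^∞ f(flow t p) dt`, expanded with `f = x f₁ + y f₂`: along the flow, `x` and `y`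
  -- become `e⁻ᵗ x` and `e⁻ᵗ (y - t x)`, which supply the integrable weights `e⁻ᵗ` and `t e⁻ᵗ`. In
  -- this form smoothness and vanishing on the axis are visible.
  let h : Smooth := coord 0 * average _ continuous_flow hC hw1 f₁
    + coord 1 * average _ continuous_flow hC hw1 f₂
    - coord 0 * average _ continuous_flow hC hw2 f₂
  have hi1 := fun p => integrable_mul_comp continuous_flow hC hw1 f₁.contDiff.continuous p
  have hi2 := fun p => integrable_mul_comp continuous_flow hC hw1 f₂.contDiff.continuous p
  have hi3 := fun p => integrable_mul_comp continuous_flow hC hw2 f₂.contDiff.continuous p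
  have hval : ∀ p t, f (flow t p) = p 0 * (Real.exp (-t) * f₁ (flow t p))
      + p 1 * (Real.exp (-t) * f₂ (flow t p)) - p 0 * (Real.exp (-t) * t * f₂ (flow t p)) := by
    intro p t
    rw [h12, hf]
    have h0 : flow t p 0 = Real.exp (-t) * p 0 := by simp [flow_apply]
    have h1 : flow t p 1 = Real.exp (-t) * (p 1 - t * p 0) := by simp [flow_apply]
    rw [h0, h1]
    ring
  have hint : ∀ p, IntegrableOn (fun t => f (flow t p)) (Set.Ioi 0) := by
    intro p
    simp only [hval]
    exact (((hi1 p).const_mul _).add ((hi2 p).const_mul _)).sub ((hi3 p).const_mul _)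
  have hh : ∀ p, h p = ∫ t in Set.Ioi 0, f (flow t p) := by
    intro p
    simp only [hval]
    have e1 := integral_sub (((hi1 p).const_mul (p 0)).add ((hi2 p).const_mul (p 1)))
      ((hi3 p).const_mul (p 0))
    have e2 := integral_add ((hi1 p).const_mul (p 0)) ((hi2 p).const_mul (p 1))
    simp only [integral_const_mul] at e1 e2
    refine Eq.trans ?_ e1.symm
    refine Eq.trans ?_ (congrArg₂ _ e2.symm rfl)
    rfl
  refine ⟨h, ?_, fun z => ?_⟩
  · ext p
    have hc : Continuous fun t => f (flow t p) :=
      f.contDiff.continuous.comp (continuous_flow.clm_apply continuous_const)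
    -- By the group law, `h (flow s p)` is the same integral started at time `s`. Its derivative at
    -- `s = 0` is `-f p`, and it is also `-(V h) p`.
    have hflow : ∀ s, h (flow s p) = h p - ∫ t in (0 : ℝ)..s, f (flow t p) := by
      intro s
      have h1 := (measurePreserving_add_right volume s).setIntegral_preimage_emb
        (measurableEmbedding_addRight s) (fun t => f (flow t p)) (Set.Ioi s)
      rw [Set.preimage_add_const_Ioi, sub_self] at h1
      have h2 : IntegrableOn (fun t => f (flow t p)) (Set.Ioi s) := by
        refine ((hc.integrableOn_Ioc (a := s) (b := 0)).union (hint p)).mono_set fun t ht => ?_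
        exact (le_or_gt t 0).imp (fun h => ⟨ht, h⟩) id
      have h3 := intervalIntegral.integral_Ioi_sub_Ioi' (hint p) h2
      rw [hh, hh, ← h3]
      simp only [flow_flow]
      rw [h1]
      ring
    have hd1 := hasDerivAt_comp_flow h p 0
    have hd2 : HasDerivAt (fun s => h (flow s p)) (-(f (flow 0 p))) 0 := by
      simp only [hflow]
      exact (intervalIntegral.integral_hasDerivAt_right (hc.intervalIntegrable _ _)
        (hc.stronglyMeasurableAtFilter _ _) hc.continuousAt).const_sub _
    have := hd1.unique hd2
    rw [flow_zero] at this
    linarith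
  · simp [h]

/-! ### Exterior products and contractions of coordinate fields -/

theorem ofFun_eq_smul (f : Smooth) : ofFun f = f • (1 : MultiVec) := by
  rw [← ofFun_mul, mul_one]

theorem del_mul_self (i : Fin 3) : del i * del i = 0 := by
  simp [del, Algebra.TensorProduct.tmul_mul_tmul]

theorem del_mul_del (i j : Fin 3) : del i * del j = -(del j * del i) := by
  rw [eq_neg_iff_add_eq_zero]
  simp only [del, Algebra.TensorProduct.tmul_mul_tmul, mul_one, ← TensorProduct.tmul_add]
  rw [ExteriorAlgebra.ι_add_mul_swap, TensorProduct.tmul_zero]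

theorem del_mul_del_mul (i j : Fin 3) (P : MultiVec) :
    del i * (del j * P) = -(del j * (del i * P)) := by
  rw [← mul_assoc, del_mul_del, neg_mul, mul_assoc]

theorem del_mul_self_mul (i : Fin 3) (P : MultiVec) : del i * (del i * P) = 0 := by
  rw [← mul_assoc, del_mul_self, zero_mul]

theorem contractL_one (i : Fin 3) : contractL i 1 = 0 := by
  simp [contractL, Algebra.TensorProduct.one_def]

theorem contractR_one (i : Fin 3) : contractR i 1 = 0 := by
  simp [contractR, Algebra.TensorProduct.one_def]

theorem contractL_del_mul (i j : Fin 3) (P : MultiVec) :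
    contractL i (del j * P) = (if i = j then P else 0) - del j * contractL i P := by
  induction P using TensorProduct.induction_on with
  | zero => simp
  | tmul f a =>
    simp only [contractL, del, Algebra.TensorProduct.tmul_mul_tmul, one_mul,
      LinearMap.baseChange_tmul, CliffordAlgebra.contractLeft_ι_mul, TensorProduct.tmul_sub]
    by_cases h : i = j
    · subst h; simp
    · simp [h]
  | add P Q hP hQ =>
    rw [mul_add, map_add, hP, hQ, map_add, mul_add]
    split_ifs <;> abel

theorem contractR_mul_del (i j : Fin 3) (P : MultiVec) :
    contractR i (P * del j) = (if i = j then P else 0) - contractR i P * del j := by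
  induction P using TensorProduct.induction_on with
  | zero => simp
  | tmul f a =>
    simp only [contractR, del, Algebra.TensorProduct.tmul_mul_tmul, mul_one,
      LinearMap.baseChange_tmul, LinearMap.flip_apply, CliffordAlgebra.contractRight_mul_ι,
      TensorProduct.tmul_sub]
    by_cases h : i = j
    · subst h; simp
    · simp [h]
  | add P Q hP hQ =>
    rw [add_mul, map_add, hP, hQ, map_add, add_mul]
    split_ifs <;> abel

theorem contractL_del (i j : Fin 3) : contractL i (del j) = if i = j then 1 else 0 := by
  have := contractL_del_mul i j 1
  simpa [contractL_one] using this

theorem contractR_del (i j : Fin 3) : contractR i (del j) = if i = j then 1 else 0 := by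
  have := contractR_mul_del i j 1
  simpa [contractR_one] using this

theorem coeffDeriv_one (i : Fin 3) : coeffDeriv i 1 = 0 := by
  simp [coeffDeriv, Algebra.TensorProduct.one_def]

theorem coeffDeriv_del_mul (i j : Fin 3) (P : MultiVec) :
    coeffDeriv i (del j * P) = del j * coeffDeriv i P := by
  induction P using TensorProduct.induction_on with
  | zero => simp
  | tmul f a => simp [coeffDeriv, del, Algebra.TensorProduct.tmul_mul_tmul]
  | add P Q hP hQ => rw [mul_add, map_add, hP, hQ, map_add, mul_add]

theorem coeffDeriv_del (i j : Fin 3) : coeffDeriv i (del j) = 0 := by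
  have := coeffDeriv_del_mul i j 1
  simpa [coeffDeriv_one] using this

/-! ### Multivector fields in coordinates -/

/-- The vector field `a ∂_x + b ∂_y + g ∂_z`. -/
def mv1 (a b g : Smooth) : MultiVec := a • del 0 + b • del 1 + g • del 2

/-- The bivector field `u ∂_x ∧ ∂_y + p ∂_x ∧ ∂_z + q ∂_y ∧ ∂_z`. -/
def mv2 (u p q : Smooth) : MultiVec :=
  u • (del 0 * del 1) + p • (del 0 * del 2) + q • (del 1 * del 2)

/-- The trivector field `h ∂_x ∧ ∂_y ∧ ∂_z`. -/
def mv3 (h : Smooth) : MultiVec := h • (del 0 * (del 1 * del 2))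

theorem mv1_add (a b g a' b' g' : Smooth) :
    mv1 a b g + mv1 a' b' g' = mv1 (a + a') (b + b') (g + g') := by
  simp only [mv1]; module

theorem mv2_add (u p q u' p' q' : Smooth) :
    mv2 u p q + mv2 u' p' q' = mv2 (u + u') (p + p') (q + q') := by
  simp only [mv2]; module

theorem mv3_add (h h' : Smooth) : mv3 h + mv3 h' = mv3 (h + h') := by
  simp only [mv3]; module

theorem smul_mv1 (f a b g : Smooth) : f • mv1 a b g = mv1 (f * a) (f * b) (f * g) := by
  simp only [mv1]; module

theorem smul_mv2 (f u p q : Smooth) : f • mv2 u p q = mv2 (f * u) (f * p) (f * q) := by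
  simp only [mv2]; module

theorem mv1_mul_mv1 (a b g a' b' g' : Smooth) :
    mv1 a b g * mv1 a' b' g' = mv2 (a * b' - b * a') (a * g' - g * a') (b * g' - g * b') := by
  simp only [mv1, mv2, add_mul, mul_add, smul_mul_assoc, mul_smul_comm, del_mul_self,
    del_mul_del 1 0, del_mul_del 2 0, del_mul_del 2 1]
  module

theorem mv1_mul_mv2 (a b g u p q : Smooth) :
    mv1 a b g * mv2 u p q = mv3 (a * q - b * p + g * u) := by
  simp only [mv1, mv2, mv3, add_mul, mul_add, smul_mul_assoc, mul_smul_comm, del_mul_self,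
    del_mul_self_mul, del_mul_del 2 1, del_mul_del_mul 1 0,
    del_mul_del_mul 2 0, del_mul_del_mul 2 1, mul_neg, mul_zero]
  module

theorem mv2_mul_mv1 (a b g u p q : Smooth) :
    mv2 u p q * mv1 a b g = mv3 (a * q - b * p + g * u) := by
  simp only [mv1, mv2, mv3, add_mul, mul_add, smul_mul_assoc, mul_smul_comm, del_mul_self,
    del_mul_self_mul, del_mul_del 1 0, del_mul_del 2 0, del_mul_del 2 1, del_mul_del_mul 1 0,
    mul_neg, mul_zero, mul_assoc]
  module

theorem coeffDeriv_ofFun (i : Fin 3) (f : Smooth) : coeffDeriv i (ofFun f) = ofFun (pderiv i f) := by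
  simp [coeffDeriv, ofFun]

theorem coeffDeriv_mv1 (i : Fin 3) (a b g : Smooth) :
    coeffDeriv i (mv1 a b g) = mv1 (pderiv i a) (pderiv i b) (pderiv i g) := by
  simp [mv1, coeffDeriv_smul, coeffDeriv_del]

theorem coeffDeriv_mv2 (i : Fin 3) (u p q : Smooth) :
    coeffDeriv i (mv2 u p q) = mv2 (pderiv i u) (pderiv i p) (pderiv i q) := by
  simp [mv2, coeffDeriv_smul, coeffDeriv_del, coeffDeriv_del_mul]

theorem coeffDeriv_mv3 (i : Fin 3) (h : Smooth) :
    coeffDeriv i (mv3 h) = mv3 (pderiv i h) := by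
  simp [mv3, coeffDeriv_smul, coeffDeriv_del, coeffDeriv_del_mul]

theorem contractR_ofFun (i : Fin 3) (f : Smooth) : contractR i (ofFun f) = 0 := by
  simp [ofFun_eq_smul, contractR_one]

theorem contractL_mv1 (i : Fin 3) (a b g : Smooth) :
    contractL i (mv1 a b g) = ofFun (![a, b, g] i) := by
  rw [ofFun_eq_smul]
  fin_cases i <;> simp [mv1, contractL_del]

theorem contractR_mv1 (i : Fin 3) (a b g : Smooth) :
    contractR i (mv1 a b g) = ofFun (![a, b, g] i) := by
  rw [ofFun_eq_smul]
  fin_cases i <;> simp [mv1, contractR_del]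

theorem contractL_mv2 (i : Fin 3) (u p q : Smooth) :
    contractL i (mv2 u p q) = ![mv1 0 u p, mv1 (-u) 0 q, mv1 (-p) (-q) 0] i := by
  fin_cases i <;> simp [mv2, mv1, contractL_del, contractL_del_mul]

theorem contractR_mv2 (i : Fin 3) (u p q : Smooth) :
    contractR i (mv2 u p q) = ![mv1 0 (-u) (-p), mv1 u 0 (-q), mv1 p q 0] i := by
  fin_cases i <;> simp [mv2, mv1, contractR_del, contractR_mul_del]

theorem contractL_mv3 (i : Fin 3) (h : Smooth) :
    contractL i (mv3 h) = ![mv2 0 0 h, mv2 0 (-h) 0, mv2 h 0 0] i := by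
  fin_cases i <;> simp [mv2, mv3, contractL_del, contractL_del_mul]

theorem contractR_mv3 (i : Fin 3) (h : Smooth) :
    contractR i (mv3 h) = ![mv2 0 0 h, mv2 0 (-h) 0, mv2 h 0 0] i := by
  rw [mv3, ← mul_assoc]
  fin_cases i <;> simp [mv2, contractR_del, contractR_mul_del]

/-- The projection of the exterior algebra onto scalars gives a left inverse. -/
theorem ofFun_injective : Function.Injective ofFun := by
  intro f g h
  have h1 := congrArg (TensorProduct.rid ℝ Smooth ∘
    (ExteriorAlgebra.algebraMapInv (R := ℝ) (M := R3)).toLinearMap.lTensor Smooth) h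
  simpa [ofFun] using h1

/-- Left contractions read off the coefficients. The same device, lowering the degree by one each
time, serves degrees two and three. -/
theorem mv1_inj {a b g a' b' g' : Smooth} (h : mv1 a b g = mv1 a' b' g') :
    a = a' ∧ b = b' ∧ g = g' := by
  have h1 := fun i => ofFun_injective
    (((contractL_mv1 i a b g).symm.trans (congrArg _ h)).trans (contractL_mv1 i a' b' g'))
  exact ⟨h1 0, h1 1, h1 2⟩

theorem mv2_inj {u p q u' p' q' : Smooth} (h : mv2 u p q = mv2 u' p' q') :
    u = u' ∧ p = p' ∧ q = q' := by
  have h1 := fun i =>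
    ((contractL_mv2 i u p q).symm.trans (congrArg _ h)).trans (contractL_mv2 i u' p' q')
  have h0 := mv1_inj (h1 0)
  exact ⟨h0.2.1, h0.2.2, (mv1_inj (h1 1)).2.2⟩

theorem mv3_inj {h h' : Smooth} (hh : mv3 h = mv3 h') : h = h' :=
  (mv2_inj (((contractL_mv3 0 h).symm.trans (congrArg _ hh)).trans (contractL_mv3 0 h'))).2.2

theorem mul_ofFun (P : MultiVec) (f : Smooth) : P * ofFun f = f • P := by
  rw [ofFun_eq_smul, mul_smul_comm, mul_one]

theorem mv1_sub (a b g a' b' g' : Smooth) :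
    mv1 a b g - mv1 a' b' g' = mv1 (a - a') (b - b') (g - g') := by
  simp only [mv1]; module

theorem mv2_sub (u p q u' p' q' : Smooth) :
    mv2 u p q - mv2 u' p' q' = mv2 (u - u') (p - p') (q - q') := by
  simp only [mv2]; module

theorem mv3_sub (h h' : Smooth) : mv3 h - mv3 h' = mv3 (h - h') := by
  simp only [mv3]; module

theorem mv1_zero : mv1 0 0 0 = 0 := by simp [mv1]
theorem mv2_zero : mv2 0 0 0 = 0 := by simp [mv2]
theorem mv3_zero : mv3 0 = 0 := by simp [mv3]
theorem ofFun_zero : ofFun 0 = 0 := by simp [ofFun]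

/-! ### The grading -/

theorem tmul_mem_multiVec {k : ℕ} (f : Smooth) {a : ExteriorAlgebra ℝ R3} (ha : a ∈ ⋀[ℝ]^k R3) :
    f ⊗ₜ[ℝ] a ∈ multiVec k :=
  Submodule.tmul_mem_baseChange_of_mem f ha

theorem multiVec_le {k : ℕ} {N : Submodule Smooth MultiVec}
    (h : ∀ a ∈ ⋀[ℝ]^k R3, (1 : Smooth) ⊗ₜ[ℝ] a ∈ N) : multiVec k ≤ N := by
  rw [multiVec, Submodule.baseChange_eq_span, Submodule.span_le]
  rintro _ ⟨a, ha, rfl⟩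
  exact h a ha

theorem mul_mem_multiVec {k l : ℕ} {P Q : MultiVec} (hP : P ∈ multiVec k) (hQ : Q ∈ multiVec l) :
    P * Q ∈ multiVec (k + l) := by
  suffices H : multiVec k ≤ (multiVec (k + l)).comap (LinearMap.mulRight Smooth Q) from H hP
  refine multiVec_le fun a ha => ?_
  suffices H : multiVec l ≤ (multiVec (k + l)).comap
    (LinearMap.mulLeft Smooth ((1 : Smooth) ⊗ₜ[ℝ] a : MultiVec)) from H hQ
  refine multiVec_le fun b hb => ?_
  simp only [Submodule.mem_comap, LinearMap.mulLeft_apply, Algebra.TensorProduct.tmul_mul_tmul]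
  refine tmul_mem_multiVec _ ?_
  rw [ExteriorAlgebra.exteriorPower, pow_add]
  exact Submodule.mul_mem_mul ha hb

/-- Degree `k + 1` is spanned over the smooth functions by products of a coordinate field with
degree `k`. This drives the induction that yields the coordinate forms in each degree and the
vanishing above degree three. -/
theorem multiVec_succ_le {k : ℕ} {N : Submodule Smooth MultiVec}
    (h : ∀ i, ∀ P ∈ multiVec k, del i * P ∈ N) : multiVec (k + 1) ≤ N := by
  refine multiVec_le fun a ha => ?_
  rw [ExteriorAlgebra.exteriorPower, pow_succ'] at ha
  refine Submodule.mul_induction_on ha ?_ fun a b ha hb => ?_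
  · rintro _ ⟨v, rfl⟩ b hb
    have : (1 : Smooth) ⊗ₜ[ℝ] (ExteriorAlgebra.ι ℝ v * b)
        = ∑ i : Fin 3, algebraMap ℝ Smooth (v i) • (del i * ((1 : Smooth) ⊗ₜ[ℝ] b : MultiVec)) := by
      conv_lhs => rw [eq_sum_single v]
      simp [del, Algebra.TensorProduct.tmul_mul_tmul, map_sum, Finset.sum_mul,
        TensorProduct.tmul_sum]
    rw [this]
    exact Submodule.sum_mem _ fun i _ => N.smul_mem _ (h i _ (tmul_mem_multiVec _ hb))
  · rw [TensorProduct.tmul_add]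
    exact N.add_mem ha hb

theorem one_mem_multiVec : (1 : MultiVec) ∈ multiVec 0 :=
  tmul_mem_multiVec 1 (by rw [ExteriorAlgebra.exteriorPower, pow_zero]; exact Submodule.one_le.1 le_rfl)

theorem ofFun_mem_multiVec (f : Smooth) : ofFun f ∈ multiVec 0 := by
  rw [ofFun_eq_smul]
  exact Submodule.smul_mem _ _ one_mem_multiVec

theorem del_mem_multiVec (i : Fin 3) : del i ∈ multiVec 1 :=
  tmul_mem_multiVec 1 (by rw [ExteriorAlgebra.exteriorPower, pow_one]; exact ⟨_, rfl⟩)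

theorem mv1_mem_multiVec (a b g : Smooth) : mv1 a b g ∈ multiVec 1 := by
  have h := fun (f : Smooth) i => (multiVec 1).smul_mem f (del_mem_multiVec i)
  exact add_mem (add_mem (h a 0) (h b 1)) (h g 2)

theorem del_mul_del_mem_multiVec (i j : Fin 3) : del i * del j ∈ multiVec 2 := by
  have := mul_mem_multiVec (del_mem_multiVec i) (del_mem_multiVec j)
  rwa [one_add_one_eq_two] at this

theorem mv2_mem_multiVec (u p q : Smooth) : mv2 u p q ∈ multiVec 2 := by
  have h := fun (f : Smooth) i j => (multiVec 2).smul_mem f (del_mul_del_mem_multiVec i j)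
  exact add_mem (add_mem (h u 0 1) (h p 0 2)) (h q 1 2)

theorem mv3_mem_multiVec (h : Smooth) : mv3 h ∈ multiVec 3 := by
  have := mul_mem_multiVec (del_mem_multiVec 0) (del_mul_del_mem_multiVec 1 2)
  rw [show 1 + 2 = 3 from rfl] at this
  exact Submodule.smul_mem _ h this

theorem exists_eq_ofFun {P : MultiVec} (hP : P ∈ multiVec 0) : ∃ f, P = ofFun f := by
  suffices H : multiVec 0 ≤ Submodule.span Smooth {1} by
    obtain ⟨f, rfl⟩ := Submodule.mem_span_singleton.1 (H hP)
    exact ⟨f, (ofFun_eq_smul f).symm⟩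
  refine multiVec_le fun a ha => ?_
  rw [ExteriorAlgebra.exteriorPower, pow_zero] at ha
  obtain ⟨r, rfl⟩ := Submodule.mem_one.1 ha
  refine Submodule.mem_span_singleton.2 ⟨algebraMap ℝ Smooth r, ?_⟩
  rw [Algebra.TensorProduct.one_def, algebraMap_smul, ← TensorProduct.tmul_smul,
    Algebra.algebraMap_eq_smul_one]

theorem del_eq_mv1 (i : Fin 3) : ∃ a b g, del i = mv1 a b g := by
  fin_cases i
  · exact ⟨1, 0, 0, by simp [mv1]⟩
  · exact ⟨0, 1, 0, by simp [mv1]⟩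
  · exact ⟨0, 0, 1, by simp [mv1]⟩

theorem exists_eq_mv1 {P : MultiVec} (hP : P ∈ multiVec 1) : ∃ a b g, P = mv1 a b g := by
  suffices H : multiVec 1 ≤ Submodule.span Smooth {del 0, del 1, del 2} by
    obtain ⟨a, b, g, rfl⟩ := Submodule.mem_span_triple.1 (H hP)
    exact ⟨a, b, g, rfl⟩
  refine multiVec_succ_le fun i Q hQ => ?_
  obtain ⟨f, rfl⟩ := exists_eq_ofFun hQ
  rw [mul_ofFun]
  refine Submodule.smul_mem _ _ (Submodule.subset_span ?_)
  fin_cases i <;> simp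

theorem exists_eq_mv2 {P : MultiVec} (hP : P ∈ multiVec 2) : ∃ u p q, P = mv2 u p q := by
  have key : ∀ {P}, P ∈ Submodule.span Smooth {del 0 * del 1, del 0 * del 2, del 1 * del 2} ↔
    ∃ u p q, mv2 u p q = P := Submodule.mem_span_triple
  suffices H : multiVec 2 ≤ Submodule.span Smooth {del 0 * del 1, del 0 * del 2, del 1 * del 2} by
    obtain ⟨a, b, g, rfl⟩ := key.1 (H hP)
    exact ⟨a, b, g, rfl⟩
  refine multiVec_succ_le fun i Q hQ => ?_
  obtain ⟨a, b, g, rfl⟩ := exists_eq_mv1 hQ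
  obtain ⟨a', b', g', hi⟩ := del_eq_mv1 i
  rw [hi, mv1_mul_mv1]
  exact key.2 ⟨_, _, _, rfl⟩

theorem exists_eq_mv3 {P : MultiVec} (hP : P ∈ multiVec 3) : ∃ h, P = mv3 h := by
  have key : ∀ {P}, P ∈ Submodule.span Smooth {del 0 * (del 1 * del 2)} ↔
    ∃ h, mv3 h = P := Submodule.mem_span_singleton
  suffices H : multiVec 3 ≤ Submodule.span Smooth {del 0 * (del 1 * del 2)} by
    obtain ⟨h, rfl⟩ := key.1 (H hP)
    exact ⟨h, rfl⟩
  refine multiVec_succ_le fun i Q hQ => ?_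
  obtain ⟨a, b, g, rfl⟩ := exists_eq_mv2 hQ
  obtain ⟨a', b', g', hi⟩ := del_eq_mv1 i
  rw [hi, mv1_mul_mv2]
  exact key.2 ⟨_, rfl⟩

theorem eq_zero_of_mem_multiVec {k : ℕ} (hk : 4 ≤ k) {P : MultiVec} (hP : P ∈ multiVec k) :
    P = 0 := by
  suffices H : multiVec k ≤ ⊥ from (Submodule.mem_bot _).1 (H hP)
  clear hP
  induction k, hk using Nat.le_induction with
  | base =>
    refine multiVec_succ_le fun i Q hQ => ?_
    obtain ⟨h, rfl⟩ := exists_eq_mv3 hQ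
    rw [Submodule.mem_bot, mv3, mul_smul_comm]
    fin_cases i
    · simp [del_mul_self_mul]
    · simp [del_mul_del_mul 1 0, del_mul_self_mul]
    · simp [del_mul_del_mul 2 0, del_mul_del_mul 2 1, del_mul_self]
  | succ k _ ih =>
    refine multiVec_succ_le fun i Q hQ => ?_
    rw [(Submodule.mem_bot _).1 (ih hQ), mul_zero]
    exact zero_mem _

/-- Reduces additive statements about inhomogeneous multivector fields to a single degree; needed
because `d_π ∘ d_π = 0` is asserted on all of `MultiVec`. -/
theorem multiVec_induction {p : MultiVec → Prop} (h : ∀ k, ∀ P ∈ multiVec k, p P)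
    (hadd : ∀ P Q, p P → p Q → p (P + Q)) (P : MultiVec) : p P := by
  induction P using TensorProduct.induction_on with
  | zero => exact h 0 0 (zero_mem _)
  | add P Q hP hQ => exact hadd P Q hP hQ
  | tmul f a =>
    induction a using DirectSum.Decomposition.inductionOn (fun k : ℕ => ⋀[ℝ]^k R3) with
    | zero => rw [TensorProduct.tmul_zero]; exact h 0 0 (zero_mem _)
    | homogeneous a => exact h _ _ (tmul_mem_multiVec f a.2)
    | add a b ha hb => rw [TensorProduct.tmul_add]; exact hadd _ _ ha hb

/-! ### Degrees of the operations -/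

theorem coeffDeriv_mem_multiVec (i : Fin 3) {k : ℕ} {P : MultiVec} (hP : P ∈ multiVec k) :
    coeffDeriv i P ∈ multiVec k := by
  match k, hP with
  | 0, hP =>
    obtain ⟨f, rfl⟩ := exists_eq_ofFun hP
    exact coeffDeriv_ofFun i f ▸ ofFun_mem_multiVec _
  | 1, hP =>
    obtain ⟨a, b, g, rfl⟩ := exists_eq_mv1 hP
    exact coeffDeriv_mv1 i a b g ▸ mv1_mem_multiVec _ _ _
  | 2, hP =>
    obtain ⟨a, b, g, rfl⟩ := exists_eq_mv2 hP
    exact coeffDeriv_mv2 i a b g ▸ mv2_mem_multiVec _ _ _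
  | 3, hP =>
    obtain ⟨h, rfl⟩ := exists_eq_mv3 hP
    exact coeffDeriv_mv3 i h ▸ mv3_mem_multiVec _
  | k + 4, hP =>
    rw [eq_zero_of_mem_multiVec (by omega) hP, map_zero]
    exact zero_mem _

theorem contractL_mem_multiVec (i : Fin 3) {k : ℕ} {P : MultiVec} (hP : P ∈ multiVec (k + 1)) :
    contractL i P ∈ multiVec k := by
  match k, hP with
  | 0, hP =>
    obtain ⟨a, b, g, rfl⟩ := exists_eq_mv1 hP
    exact contractL_mv1 i a b g ▸ ofFun_mem_multiVec _
  | 1, hP =>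
    obtain ⟨a, b, g, rfl⟩ := exists_eq_mv2 hP
    rw [contractL_mv2]
    fin_cases i <;> exact mv1_mem_multiVec _ _ _
  | 2, hP =>
    obtain ⟨h, rfl⟩ := exists_eq_mv3 hP
    rw [contractL_mv3]
    fin_cases i <;> exact mv2_mem_multiVec _ _ _
  | k + 3, hP =>
    rw [eq_zero_of_mem_multiVec (by omega) hP, map_zero]
    exact zero_mem _

theorem contractR_mem_multiVec (i : Fin 3) {k : ℕ} {P : MultiVec} (hP : P ∈ multiVec (k + 1)) :
    contractR i P ∈ multiVec k := by
  match k, hP with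
  | 0, hP =>
    obtain ⟨a, b, g, rfl⟩ := exists_eq_mv1 hP
    exact contractR_mv1 i a b g ▸ ofFun_mem_multiVec _
  | 1, hP =>
    obtain ⟨a, b, g, rfl⟩ := exists_eq_mv2 hP
    rw [contractR_mv2]
    fin_cases i <;> exact mv1_mem_multiVec _ _ _
  | 2, hP =>
    obtain ⟨h, rfl⟩ := exists_eq_mv3 hP
    rw [contractR_mv3]
    fin_cases i <;> exact mv2_mem_multiVec _ _ _
  | k + 3, hP =>
    rw [eq_zero_of_mem_multiVec (by omega) hP, map_zero]
    exact zero_mem _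

theorem schouten_mem_multiVec {k l : ℕ} {P Q : MultiVec} (hP : P ∈ multiVec (k + 1))
    (hQ : Q ∈ multiVec (l + 1)) : schouten P Q ∈ multiVec (k + l + 1) := by
  refine Submodule.sum_mem _ fun i _ => sub_mem ?_ ?_
  · rw [add_assoc]
    exact mul_mem_multiVec (contractR_mem_multiVec i hP) (coeffDeriv_mem_multiVec i hQ)
  · rw [add_right_comm]
    exact mul_mem_multiVec (coeffDeriv_mem_multiVec i hP) (contractL_mem_multiVec i hQ)

/-! ### The Schouten bracket in coordinates -/

theorem schouten_mv1_mv1 (a b g a' b' g' : Smooth) :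
    schouten (mv1 a b g) (mv1 a' b' g') =
      mv1 (a * pderiv 0 a' + b * pderiv 1 a' + g * pderiv 2 a'
            - (a' * pderiv 0 a + b' * pderiv 1 a + g' * pderiv 2 a))
          (a * pderiv 0 b' + b * pderiv 1 b' + g * pderiv 2 b'
            - (a' * pderiv 0 b + b' * pderiv 1 b + g' * pderiv 2 b))
          (a * pderiv 0 g' + b * pderiv 1 g' + g * pderiv 2 g'
            - (a' * pderiv 0 g + b' * pderiv 1 g + g' * pderiv 2 g)) := by
  simp only [schouten, Fin.sum_univ_three, contractR_mv1, contractL_mv1, coeffDeriv_mv1,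
    ofFun_mul, mul_ofFun, smul_mv1, mv1_sub, mv1_add, Matrix.cons_val]
  congr 1 <;> ring

theorem schouten_mv1_mv2 (a b g u p q : Smooth) :
    schouten (mv1 a b g) (mv2 u p q) =
      mv2 (a * pderiv 0 u + b * pderiv 1 u + g * pderiv 2 u
            - u * (pderiv 0 a + pderiv 1 b) - p * pderiv 2 b + q * pderiv 2 a)
          (a * pderiv 0 p + b * pderiv 1 p + g * pderiv 2 p
            - p * (pderiv 0 a + pderiv 2 g) - u * pderiv 1 g - q * pderiv 1 a)
          (a * pderiv 0 q + b * pderiv 1 q + g * pderiv 2 q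
            - q * (pderiv 1 b + pderiv 2 g) + u * pderiv 0 g - p * pderiv 0 b) := by
  simp only [schouten, Fin.sum_univ_three, contractR_mv1, contractL_mv2, coeffDeriv_mv1,
    coeffDeriv_mv2, ofFun_mul, mv1_mul_mv1, smul_mv2, mv2_sub, mv2_add, Matrix.cons_val]
  congr 1 <;> ring

theorem schouten_mv2_mv1 (a b g u p q : Smooth) :
    schouten (mv2 u p q) (mv1 a b g) = -schouten (mv1 a b g) (mv2 u p q) := by
  rw [schouten_mv1_mv2, eq_neg_iff_add_eq_zero, ← mv2_zero]
  simp only [schouten, Fin.sum_univ_three, contractL_mv1, contractR_mv2, coeffDeriv_mv1,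
    coeffDeriv_mv2, mul_ofFun, mv1_mul_mv1, smul_mv2, mv2_sub, mv2_add, Matrix.cons_val]
  congr 1 <;> ring

theorem semiOpenBook_eq : semiOpenBook = mv2 0 (coord 0) (coord 0 + coord 1) := by
  simp only [semiOpenBook, eulerField, mv2, add_mul, smul_mul_assoc]
  module

theorem schouten_semiOpenBook_ofFun (f : Smooth) : schouten semiOpenBook (ofFun f) =
    mv1 (coord 0 * pderiv 2 f) ((coord 0 + coord 1) * pderiv 2 f) (-lieV f) := by
  simp only [schouten_ofFun, semiOpenBook_eq, Fin.sum_univ_three, contractR_mv2, mul_ofFun,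
    smul_mv1, mv1_add, lieV, Matrix.cons_val]
  congr 1 <;> ring

/-- The terms `V a - a` and `V b - a - b` are the components of the Lie bracket of `V` with `a ∂_x +
b ∂_y`. -/
theorem schouten_semiOpenBook_mv1 (a b g : Smooth) : schouten semiOpenBook (mv1 a b g) =
    mv2 (coord 0 * pderiv 2 b - (coord 0 + coord 1) * pderiv 2 a)
      (lieV a - a + coord 0 * pderiv 2 g)
      (lieV b - a - b + (coord 0 + coord 1) * pderiv 2 g) := by
  rw [semiOpenBook_eq, schouten_mv2_mv1, schouten_mv1_mv2, ← zero_sub, ← mv2_zero, mv2_sub]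
  simp only [lieV, pderiv_coord, map_add, map_zero, Fin.reduceEq, if_true, if_false]
  congr 1 <;> ring

/-- The combination `V u - 2 u` is the Lie derivative of `u ∂_x ∧ ∂_y` along `V`, whose divergence
is `2`. -/
theorem schouten_semiOpenBook_mv2 (u p q : Smooth) : schouten semiOpenBook (mv2 u p q) =
    mv3 (coord 0 * pderiv 2 q - (coord 0 + coord 1) * pderiv 2 p - lieV u + 2 * u) := by
  simp only [schouten, Fin.sum_univ_three, semiOpenBook_eq, contractL_mv2, contractR_mv2,
    coeffDeriv_mv2, mv1_mul_mv2, mv2_mul_mv1, mv3_sub, mv3_add, lieV, pderiv_coord, map_add,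
    map_zero, Matrix.cons_val, Fin.reduceEq, if_true, if_false]
  congr 1
  ring

/-! ### Derivatives along `V` -/

theorem lieV_add (f g : Smooth) : lieV (f + g) = lieV f + lieV g := by
  simp only [lieV, map_add]; ring

theorem lieV_sub (f g : Smooth) : lieV (f - g) = lieV f - lieV g := by
  simp only [lieV, map_sub]; ring

theorem lieV_neg (f : Smooth) : lieV (-f) = -lieV f := by
  simp only [lieV, map_neg]; ring

theorem lieV_mul (f g : Smooth) : lieV (f * g) = f * lieV g + lieV f * g := by
  simp only [lieV, pderiv_mul]; ring

@[simp] theorem lieV_zero : lieV 0 = 0 := by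
  simp [lieV]

@[simp] theorem lieV_algebraMap (r : ℝ) : lieV (algebraMap ℝ Smooth r) = 0 := by
  simp [lieV]

@[simp] theorem lieV_coord_zero : lieV (coord 0) = coord 0 := by
  simp [lieV, pderiv_coord]

@[simp] theorem lieV_coord_one : lieV (coord 1) = coord 0 + coord 1 := by
  simp [lieV, pderiv_coord]

@[simp] theorem lieV_coord_two : lieV (coord 2) = 0 := by
  simp [lieV, pderiv_coord]

/-- This is `[∂_x, V] = ∂_x + ∂_y`; the next two lemmas are `[∂_y, V] = ∂_y` and `[∂_z, V] = 0`. -/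
theorem pderiv_zero_lieV (f : Smooth) :
    pderiv 0 (lieV f) = lieV (pderiv 0 f) + pderiv 0 f + pderiv 1 f := by
  simp only [lieV, map_add, pderiv_mul, pderiv_coord, pderiv_comm 0 1, Fin.reduceEq, if_true,
    if_false]
  ring

theorem pderiv_one_lieV (f : Smooth) :
    pderiv 1 (lieV f) = lieV (pderiv 1 f) + pderiv 1 f := by
  simp only [lieV, map_add, pderiv_mul, pderiv_coord, pderiv_comm 0 1, Fin.reduceEq, if_true,
    if_false]
  ring

theorem pderiv_two_lieV (f : Smooth) : pderiv 2 (lieV f) = lieV (pderiv 2 f) := by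
  simp only [lieV, map_add, pderiv_mul, pderiv_coord, pderiv_comm 2 1, pderiv_comm 2 0,
    Fin.reduceEq, if_false]
  ring

theorem lieV_apply_axis (f : Smooth) (z : ℝ) : lieV f ![0, 0, z] = 0 := by
  simp [lieV]

theorem lieV_apply_zero (f : Smooth) : lieV f 0 = 0 := by
  simp [lieV]

/-! ### Linear changes of variables, and functions independent of `z` -/

/-- The composite of a smooth function with a linear map. -/
def compLinear (A : R3 →L[ℝ] R3) (f : Smooth) : Smooth :=
  ⟨fun p => f (A p), mem_smoothFunctions.2 (f.contDiff.comp A.contDiff)⟩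

theorem compLinear_apply (A : R3 →L[ℝ] R3) (f : Smooth) (p : R3) : compLinear A f p = f (A p) := rfl

theorem pderiv_compLinear_of_eq_zero {A : R3 →L[ℝ] R3} {i : Fin 3} (h : A (Pi.single i 1) = 0)
    (f : Smooth) : pderiv i (compLinear A f) = 0 := by
  ext p
  have := (f.differentiableAt (A p)).hasFDerivAt.comp p A.hasFDerivAt
  change fderiv ℝ (f.1 ∘ A) p (Pi.single i 1) = 0
  rw [this.fderiv, ContinuousLinearMap.comp_apply, h, map_zero]

theorem apply_eq_of_pderiv_two_eq_zero {f : Smooth} (h : pderiv 2 f = 0) (p : R3) :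
    f p = f ![p 0, p 1, 0] := by
  have hd : ∀ t : ℝ, HasDerivAt (fun s : ℝ => f ![p 0, p 1, s]) 0 t := by
    intro t
    have h1 : HasDerivAt (fun s : ℝ => ![p 0, p 1, s]) ![0, 0, 1] t := by
      rw [hasDerivAt_pi]
      intro i
      fin_cases i
      · exact hasDerivAt_const t (p 0)
      · exact hasDerivAt_const t (p 1)
      · exact hasDerivAt_id t
    have h2 := (f.differentiableAt ![p 0, p 1, t]).hasFDerivAt.comp_hasDerivAt t h1
    rw [fderiv_eq_sum] at h2
    refine h2.congr_deriv ?_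
    simp [Fin.sum_univ_three, h]
  have := is_const_of_deriv_eq_zero (fun t => (hd t).differentiableAt) (fun t => (hd t).deriv)
    (p 2) 0
  have h4 : ![p 0, p 1, p 2] = p := by ext i; fin_cases i <;> rfl
  simpa only [h4] using this

theorem eq_algebraMap_of_lieV_eq_zero {f : Smooth} (h : lieV f = 0) (h2 : pderiv 2 f = 0) :
    f = algebraMap ℝ Smooth (f 0) := by
  ext p
  rw [apply_eq_of_lieV_eq_zero h, apply_eq_of_pderiv_two_eq_zero h2, Smooth.algebraMap_apply]
  exact congrArg f.1 (by ext i; fin_cases i <;> rfl)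

/-- The solution vanishing on the axis is itself independent of `z`: its `z`-derivative is
`V`-invariant, hence determined by its values on the axis, where it is zero. -/
theorem exists_lieV_eq_of_pderiv_two_eq_zero {f : Smooth} (h : pderiv 2 f = 0) (h0 : f 0 = 0) :
    ∃ g : Smooth, lieV g = f ∧ pderiv 2 g = 0 := by
  have hf : ∀ z, f ![0, 0, z] = 0 := by
    intro z
    rw [apply_eq_of_pderiv_two_eq_zero h]
    exact (congrArg f.1 (by ext i; fin_cases i <;> rfl)).trans h0
  obtain ⟨g, hg, hgz⟩ := exists_lieV_eq hf
  refine ⟨g, hg, ?_⟩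
  have h1 : lieV (pderiv 2 g) = 0 := by rw [← pderiv_two_lieV, hg, h]
  obtain ⟨k, l, hkl⟩ := hadamard_xy g
  have hkl' : g = coord 0 * k + coord 1 * l := by
    ext p
    simp [hkl p, hgz]
  ext p
  rw [apply_eq_of_lieV_eq_zero h1, hkl']
  simp [pderiv_mul, pderiv_coord]

/-- Hadamard's coefficients may depend on `z`; replacing them by their restrictions to `z = 0`,
pulled back along the projection, cures this. -/
theorem exists_eq_add_mul_of_pderiv_two_eq_zero {f : Smooth} (h : pderiv 2 f = 0) :
    ∃ g k : Smooth, pderiv 2 g = 0 ∧ pderiv 2 k = 0 ∧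
      f = algebraMap ℝ Smooth (f 0) + coord 0 * g + coord 1 * k := by
  obtain ⟨g, k, hgk⟩ := hadamard_xy f
  have hA : (axisProj 0 + axisProj 1) (Pi.single 2 1) = 0 := by
    ext i; simp [axisProj_apply]
  refine ⟨compLinear (axisProj 0 + axisProj 1) g, compLinear (axisProj 0 + axisProj 1) k,
    pderiv_compLinear_of_eq_zero hA _, pderiv_compLinear_of_eq_zero hA _, ?_⟩
  ext p
  have hp : (axisProj 0 + axisProj 1) p = ![p 0, p 1, 0] := by
    ext i; fin_cases i <;> simp [axisProj_apply]
  have h0 : ![0, 0, 0] = (0 : R3) := by ext i; fin_cases i <;> rfl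
  rw [apply_eq_of_pderiv_two_eq_zero h, hgk]
  simp [compLinear_apply, hp, h0]

/-! ### The equations `V(a) - a = p` -/

/-- For `a = x a₁ + y s - c` with `c` constant, `V a - a = x (V a₁ + s) + y V s + c`. A
`V`-derivative vanishes at the origin, so `p₂ 0`, the coefficient of `y`, is the only obstruction;
the constant in `s` is chosen so that the equation for `a₁` has none. -/
theorem exists_lieV_sub_self {p : Smooth} (h : pderiv 2 p = 0) :
    ∃ (a : Smooth) (β : ℝ), pderiv 2 a = 0 ∧
      p = lieV a - a + algebraMap ℝ Smooth β * coord 1 := by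
  obtain ⟨p₁, p₂, h1, h2, hp⟩ := exists_eq_add_mul_of_pderiv_two_eq_zero h
  obtain ⟨a₂, ha₂, ha₂'⟩ := exists_lieV_eq_of_pderiv_two_eq_zero
    (f := p₂ - algebraMap ℝ Smooth (p₂ 0)) (by simp [h2]) (by simp)
  obtain ⟨a₁, ha₁, ha₁'⟩ := exists_lieV_eq_of_pderiv_two_eq_zero
    (f := p₁ - (a₂ + algebraMap ℝ Smooth (p₁ 0 - a₂ 0))) (by simp [h1, ha₂']) (by simp)
  refine ⟨coord 0 * a₁ + coord 1 * (a₂ + algebraMap ℝ Smooth (p₁ 0 - a₂ 0))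
    - algebraMap ℝ Smooth (p 0), p₂ 0, ?_, ?_⟩
  · simp [pderiv_mul, pderiv_coord, ha₁', ha₂']
  · simp only [lieV_sub, lieV_add, lieV_mul, lieV_algebraMap, lieV_coord_zero, lieV_coord_one, ha₁,
      ha₂]
    linear_combination hp

theorem exists_lieV_system {p q : Smooth} (hp : pderiv 2 p = 0) (hq : pderiv 2 q = 0) :
    ∃ (a b g : Smooth) (β : ℝ), pderiv 2 a = 0 ∧ pderiv 2 b = 0 ∧ pderiv 2 g = 0 ∧
      p = lieV a - a + coord 0 * g + algebraMap ℝ Smooth β * coord 1 ∧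
      q = lieV b - a - b + (coord 0 + coord 1) * g := by
  obtain ⟨a, β, ha, hpa⟩ := exists_lieV_sub_self hp
  obtain ⟨b, γ, hb, hqb⟩ := exists_lieV_sub_self (p := q + a) (by simp [hq, ha])
  have h2 : algebraMap ℝ Smooth γ = 2 * algebraMap ℝ Smooth (γ / 2) := by
    ext p; change γ = 2 * (γ / 2); ring
  rw [h2] at hqb
  -- The obstruction `γ y` in the second equation is removed by `g = γ/2`; subtracting `(γ/2) y`
  -- from `a` leaves the first equation unchanged, and from `a` and `b` together yields exactly `γ
  -- y` in the second.
  refine ⟨a - algebraMap ℝ Smooth (γ / 2) * coord 1, b - algebraMap ℝ Smooth (γ / 2) * coord 1,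
    algebraMap ℝ Smooth (γ / 2), β, ?_, ?_, ?_, ?_, ?_⟩
  · simp [pderiv_mul, pderiv_coord, ha]
  · simp [pderiv_mul, pderiv_coord, hb]
  · simp
  · simp only [lieV_sub, lieV_mul, lieV_algebraMap, lieV_coord_one]
    linear_combination hpa
  · simp only [lieV_sub, lieV_mul, lieV_algebraMap, lieV_coord_one]
    linear_combination hqb

theorem eq_of_pderiv_eq_algebraMap {f : Smooth} {r s t : ℝ} (h0 : pderiv 0 f = algebraMap ℝ Smooth r)
    (h1 : pderiv 1 f = algebraMap ℝ Smooth s) (h2 : pderiv 2 f = algebraMap ℝ Smooth t) :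
    f = algebraMap ℝ Smooth (f 0) + algebraMap ℝ Smooth r * coord 0
      + algebraMap ℝ Smooth s * coord 1 + algebraMap ℝ Smooth t * coord 2 := by
  have hd : ∀ i, pderiv i (f - (algebraMap ℝ Smooth r * coord 0
      + algebraMap ℝ Smooth s * coord 1 + algebraMap ℝ Smooth t * coord 2)) = 0 := by
    intro i
    fin_cases i <;> simp [pderiv_mul, pderiv_coord, h0, h1, h2]
  have := eq_algebraMap_of_lieV_eq_zero (by simp [lieV, hd]) (hd 2)
  rw [sub_eq_iff_eq_add] at this
  rw [this]
  ext p
  simp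
  ring

/-- The smooth vector fields on the plane that commute with `V`. -/
theorem exists_of_lieV_eq_self {a b : Smooth} (ha : lieV a = a) (hb : lieV b = a + b)
    (ha2 : pderiv 2 a = 0) (hb2 : pderiv 2 b = 0) :
    ∃ c e : ℝ, a = algebraMap ℝ Smooth c * coord 0 ∧
      b = algebraMap ℝ Smooth c * (coord 0 + coord 1) + algebraMap ℝ Smooth e * coord 0 := by
  have key : ∀ {f : Smooth} (r : ℝ), lieV f = algebraMap ℝ Smooth r → pderiv 2 f = 0 →
      r = 0 ∧ f = algebraMap ℝ Smooth (f 0) := by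
    intro f r h h2
    have hr : r = 0 := by
      rw [← lieV_apply_zero f, h, Smooth.algebraMap_apply]
    exact ⟨hr, eq_algebraMap_of_lieV_eq_zero (by rw [h, hr, map_zero]) h2⟩
  have h2 : ∀ (i : Fin 3) {f : Smooth}, pderiv 2 f = 0 → pderiv 2 (pderiv i f) = 0 := by
    intro i f hf
    rw [pderiv_comm, hf, map_zero]
  have a0 : a 0 = 0 := by rw [← ha, lieV_apply_zero]
  have b0 : b 0 = 0 := by
    have := congrArg (fun f : Smooth => f 0) hb
    simpa [lieV_apply_zero, a0] using this.symm
  have e1 := pderiv_one_lieV a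
  rw [ha] at e1
  have a1 := (key 0 (by rw [map_zero]; linear_combination -e1) (h2 1 ha2)).2
  have e2 := pderiv_zero_lieV a
  rw [ha] at e2
  -- The commutator gives `V (∂a/∂x) = -∂a/∂y`, a constant. A constant `V`-derivative is zero, so
  -- `∂a/∂y = 0` and `∂a/∂x` is constant. The same argument for `b` forces `∂b/∂y = ∂a/∂x`.
  obtain ⟨r0, a2⟩ := key (f := pderiv 0 a) (-(pderiv 1 a 0))
    (by rw [map_neg, ← a1]; linear_combination -e2) (h2 0 ha2)
  rw [neg_eq_zero] at r0
  rw [r0] at a1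
  have e3 := pderiv_one_lieV b
  rw [hb, map_add, a1] at e3
  have b1 := (key 0 (by rw [map_zero] at e3 ⊢; linear_combination -e3) (h2 1 hb2)).2
  have e4 := pderiv_zero_lieV b
  rw [hb, map_add] at e4
  obtain ⟨r1, b2⟩ := key (f := pderiv 0 b) (pderiv 0 a 0 - pderiv 1 b 0)
    (by rw [map_sub, ← a2, ← b1]; linear_combination -e4) (h2 0 hb2)
  rw [sub_eq_zero] at r1
  rw [← r1] at b1
  refine ⟨pderiv 0 a 0, pderiv 0 b 0 - pderiv 0 a 0, ?_, ?_⟩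
  · have := eq_of_pderiv_eq_algebraMap a2 a1 (t := 0) (by rw [ha2, map_zero])
    simpa [a0] using this
  · have := eq_of_pderiv_eq_algebraMap b2 b1 (t := 0) (by rw [hb2, map_zero])
    rw [b0, map_zero] at this
    rw [map_sub]
    linear_combination this

/-! ### Cocycles in coordinates -/

/-- The hypotheses are the three components of the cocycle equation. The potential `F` is assembled
from a part removing the `z`-dependence of `a` and `b`, a part linear in `z`, and a planar part; the
fields that resist are `α x ∂_y + γ ∂_z`. -/
theorem exists_of_cocycle_one {a b g : Smooth}
    (h1 : coord 0 * pderiv 2 b - (coord 0 + coord 1) * pderiv 2 a = 0)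
    (h2 : lieV a - a + coord 0 * pderiv 2 g = 0)
    (h3 : lieV b - a - b + (coord 0 + coord 1) * pderiv 2 g = 0) :
    ∃ (F : Smooth) (α γ : ℝ), a = coord 0 * pderiv 2 F ∧
      b = (coord 0 + coord 1) * pderiv 2 F + algebraMap ℝ Smooth α * coord 0 ∧
      g = -lieV F + algebraMap ℝ Smooth γ := by
  obtain ⟨k, hak, hbk⟩ := exists_of_koszul (sub_eq_zero.1 h1)
  obtain ⟨K, hK⟩ := exists_pderiv_two k
  obtain ⟨F₁, hF₁⟩ := exists_pderiv_two K
  -- Subtracting `d_π F₁`, where `∂F₁/∂z = K`, makes the first two coefficients independent of `z`.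
  obtain ⟨a', ha'⟩ : ∃ a', a' = a - coord 0 * K := ⟨_, rfl⟩
  obtain ⟨b', hb'⟩ : ∃ b', b' = b - (coord 0 + coord 1) * K := ⟨_, rfl⟩
  obtain ⟨g', hg'⟩ : ∃ g', g' = g + lieV F₁ := ⟨_, rfl⟩
  have ha2 : pderiv 2 a' = 0 := by simp [ha', pderiv_mul, pderiv_coord, hak, hK]
  have hb2 : pderiv 2 b' = 0 := by simp [hb', pderiv_mul, pderiv_coord, hbk, hK]
  have h2' : lieV a' - a' + coord 0 * pderiv 2 g' = 0 := by
    rw [ha', hg', map_add, pderiv_two_lieV, hF₁, lieV_sub, lieV_mul, lieV_coord_zero]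
    linear_combination h2
  have h3' : lieV b' - a' - b' + (coord 0 + coord 1) * pderiv 2 g' = 0 := by
    rw [ha', hb', hg', map_add, pderiv_two_lieV, hF₁, lieV_sub, lieV_mul, lieV_add,
      lieV_coord_zero, lieV_coord_one]
    linear_combination h3
  obtain ⟨g₁, hg₁⟩ : ∃ g₁, g₁ = pderiv 2 g' := ⟨_, rfl⟩
  rw [← hg₁] at h2' h3'
  have hg₁2 : pderiv 2 g₁ = 0 := by
    refine eq_zero_of_coord_mul (i := 0) ?_
    have := congrArg (pderiv 2) h2'
    simpa [pderiv_two_lieV, ha2, pderiv_mul, pderiv_coord] using this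
  -- At the origin, the `x`-derivative of the second equation gives `g₁ = -∂a'/∂y` and the
  -- `y`-derivative of the third gives `g₁ = ∂a'/∂y`.
  have hg₁0 : g₁ 0 = 0 := by
    have e1 := congrArg (fun f => (pderiv 0 f : Smooth) 0) h2'
    have e2 := congrArg (fun f => (pderiv 1 f : Smooth) 0) h3'
    have e3 := congrArg (fun f => (pderiv 1 f : Smooth) 0) h2'
    simp [pderiv_zero_lieV, pderiv_one_lieV, pderiv_mul, pderiv_coord, lieV_apply_zero] at e1 e2 e3
    linarith
  obtain ⟨h, hh, hh2⟩ := exists_lieV_eq_of_pderiv_two_eq_zero hg₁2 hg₁0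
  -- Adding `h V` to the planar part turns it into a field commuting with `V`; in terms of the
  -- potential this is the term `-z h`.
  obtain ⟨c, e, hc, he⟩ := exists_of_lieV_eq_self (a := a' + coord 0 * h)
    (b := b' + (coord 0 + coord 1) * h)
    (by rw [lieV_add, lieV_mul, lieV_coord_zero, hh]; linear_combination h2')
    (by
      rw [lieV_add, lieV_mul, lieV_add, lieV_coord_zero, lieV_coord_one, hh]
      linear_combination h3')
    (by simp [ha2, hh2, pderiv_mul, pderiv_coord]) (by simp [hb2, hh2, pderiv_mul, pderiv_coord])
  have hg2 : pderiv 2 (g' - coord 2 * g₁) = 0 := by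
    simp [pderiv_mul, pderiv_coord, hg₁2, ← hg₁]
  obtain ⟨m, hm, hm2⟩ := exists_lieV_eq_of_pderiv_two_eq_zero
    (f := g' - coord 2 * g₁ - algebraMap ℝ Smooth (g' 0)) (by simp [hg2]) (by simp)
  -- The term `c z` accounts for `c V = d_π (c z)`, and `m` for the planar part of the `∂_z`
  -- coefficient, up to the constant `g' 0`.
  refine ⟨F₁ - coord 2 * h + algebraMap ℝ Smooth c * coord 2 - m, e, g' 0, ?_, ?_, ?_⟩
  · simp only [map_sub, map_add, pderiv_mul, pderiv_coord, pderiv_algebraMap, hF₁, hh2, hm2,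
      if_true]
    linear_combination hc - ha'
  · simp only [map_sub, map_add, pderiv_mul, pderiv_coord, pderiv_algebraMap, hF₁, hh2, hm2,
      if_true]
    linear_combination he - hb'
  · simp only [lieV_sub, lieV_add, lieV_mul, lieV_coord_two, lieV_algebraMap, hm, hh]
    linear_combination -hg'

/-- The coefficient `u` is removed first; the Koszul relation then controls the `z`-dependence of
`p` and `q`, and `exists_lieV_system` handles what is left in the plane. -/
theorem exists_of_cocycle_two {u p q : Smooth}
    (h : coord 0 * pderiv 2 q - (coord 0 + coord 1) * pderiv 2 p - lieV u + 2 * u = 0) :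
    ∃ (a b g : Smooth) (β : ℝ),
      u = coord 0 * pderiv 2 b - (coord 0 + coord 1) * pderiv 2 a ∧
      p = lieV a - a + coord 0 * pderiv 2 g + algebraMap ℝ Smooth β * coord 1 ∧
      q = lieV b - a - b + (coord 0 + coord 1) * pderiv 2 g := by
  -- On the axis the cocycle equation reduces to `2 u = 0`.
  have hu : ∀ z, u ![0, 0, z] = 0 := by
    intro z
    have := congrArg (fun f : Smooth => f ![0, 0, z]) h
    simp [lieV_apply_axis] at this
    exact this.resolve_left (two_ne_zero (α := ℝ))
  obtain ⟨u₁, u₂, hu12⟩ := hadamard_xy u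
  have hu' : u = coord 0 * u₁ + coord 1 * u₂ := by
    ext r
    simp [hu12 r, hu]
  -- Chosen so that `x ∂b₁/∂z - (x + y) ∂a₁/∂z = x (u₁ - u₂) + (x + y) u₂ = u`.
  obtain ⟨a₁, ha₁⟩ := exists_pderiv_two (-u₂)
  obtain ⟨b₁, hb₁⟩ := exists_pderiv_two (u₁ - u₂)
  obtain ⟨k, hpk, hqk⟩ := exists_of_koszul (a := pderiv 2 (p - (lieV a₁ - a₁)))
    (b := pderiv 2 (q - (lieV b₁ - a₁ - b₁))) (by
      simp only [map_sub, pderiv_two_lieV, ha₁, hb₁, lieV_sub, lieV_neg]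
      have := h
      simp only [hu', lieV_add, lieV_mul, lieV_coord_zero, lieV_coord_one] at this
      linear_combination this)
  obtain ⟨K, hK⟩ := exists_pderiv_two k
  obtain ⟨a, b, g, β, ha, hb, hg, hp, hq⟩ := exists_lieV_system
    (p := p - (lieV a₁ - a₁) - coord 0 * K)
    (q := q - (lieV b₁ - a₁ - b₁) - (coord 0 + coord 1) * K)
    (by rw [map_sub, hpk]; simp [pderiv_mul, pderiv_coord, hK])
    (by rw [map_sub, hqk]; simp [pderiv_mul, pderiv_coord, hK])
  obtain ⟨G, hG⟩ := exists_pderiv_two (K + g)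
  refine ⟨a₁ + a, b₁ + b, G, β, ?_, ?_, ?_⟩
  · rw [map_add, map_add, ha, hb, ha₁, hb₁, hu']
    ring
  · rw [hG, lieV_add]
    linear_combination hp
  · rw [hG, lieV_add]
    linear_combination hq

/-- The part of `h` vanishing on the axis lies in the ideal `(x, x + y)` and is reached through
`z`-primitives. The rest depends on `z` alone, so `V` kills it and half of it serves as `u`. -/
theorem exists_of_degree_three (h : Smooth) : ∃ u p q : Smooth,
    h = coord 0 * pderiv 2 q - (coord 0 + coord 1) * pderiv 2 p - lieV u + 2 * u := by
  obtain ⟨h₁, h₂, h12⟩ := hadamard_xy h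
  have hA : ∀ i : Fin 3, i ≠ 2 → axisProj 2 (Pi.single i 1) = 0 := by
    intro i hi; ext j; simp [axisProj_apply, Ne.symm hi]
  obtain ⟨p, hp⟩ := exists_pderiv_two (-h₂)
  obtain ⟨q, hq⟩ := exists_pderiv_two (h₁ - h₂)
  refine ⟨algebraMap ℝ Smooth (1 / 2) * compLinear (axisProj 2) h, p, q, ?_⟩
  have hu : lieV (compLinear (axisProj 2) h) = 0 := by
    simp [lieV, pderiv_compLinear_of_eq_zero (hA _ _)]
  rw [lieV_mul, hu, lieV_algebraMap, hp, hq]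
  ext r
  have h1 : axisProj 2 r = ![0, 0, r 2] := by
    ext i; fin_cases i <;> simp [axisProj_apply]
  have h2 : (2 : Smooth) r = 2 := rfl
  rw [h12]
  simp [compLinear_apply, h1, h2]
  ring

/-! ### The differential -/

theorem add_schouten (P Q R : MultiVec) :
    schouten (P + Q) R = schouten P R + schouten Q R := by
  simp only [schouten, map_add, add_mul, ← Finset.sum_add_distrib]
  refine Finset.sum_congr rfl fun i _ => ?_
  abel

theorem semiOpenBook_mem_multiVec : semiOpenBook ∈ multiVec 2 :=
  semiOpenBook_eq ▸ mv2_mem_multiVec _ _ _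

theorem schouten_semiOpenBook_mem {k : ℕ} {P : MultiVec} (hP : P ∈ multiVec k) :
    schouten semiOpenBook P ∈ multiVec (k + 1) := by
  match k, hP with
  | 0, hP =>
    obtain ⟨f, rfl⟩ := exists_eq_ofFun hP
    exact schouten_semiOpenBook_ofFun f ▸ mv1_mem_multiVec _ _ _
  | k + 1, hP =>
    have := schouten_mem_multiVec (k := 1) semiOpenBook_mem_multiVec hP
    rwa [add_comm 1 k] at this

theorem schouten_semiOpenBook_eq_zero {k : ℕ} (hk : 3 ≤ k) {P : MultiVec} (hP : P ∈ multiVec k) :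
    schouten semiOpenBook P = 0 :=
  eq_zero_of_mem_multiVec (Nat.succ_le_succ hk) (schouten_semiOpenBook_mem hP)

theorem schouten_semiOpenBook_self : schouten semiOpenBook semiOpenBook = 0 := by
  have h := schouten_semiOpenBook_mv2 0 (coord 0) (coord 0 + coord 1)
  rw [← semiOpenBook_eq] at h
  rw [h, ← mv3_zero]
  congr 1
  simp [pderiv_coord]

theorem schouten_semiOpenBook_schouten (P : MultiVec) :
    schouten semiOpenBook (schouten semiOpenBook P) = 0 := by
  induction P using multiVec_induction with
  | hadd P Q hP hQ => rw [schouten_add, schouten_add, hP, hQ, add_zero]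
  | h k P hP =>
    match k, hP with
    | 0, hP =>
      obtain ⟨f, rfl⟩ := exists_eq_ofFun hP
      rw [schouten_semiOpenBook_ofFun, schouten_semiOpenBook_mv1, ← mv2_zero]
      congr 1 <;>
      simp only [lieV, map_add, map_neg, pderiv_mul, pderiv_coord,
        pderiv_comm 2 0, pderiv_comm 2 1, Fin.reduceEq, if_true, if_false] <;> ring
    | 1, hP =>
      obtain ⟨a, b, g, rfl⟩ := exists_eq_mv1 hP
      rw [schouten_semiOpenBook_mv1, schouten_semiOpenBook_mv2, ← mv3_zero]
      congr 1
      simp only [lieV, map_add, map_sub, pderiv_mul, pderiv_coord,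
        pderiv_comm 2 0, pderiv_comm 2 1, Fin.reduceEq, if_true, if_false]
      ring
    | k + 2, hP =>
      exact schouten_semiOpenBook_eq_zero (by omega) (schouten_semiOpenBook_mem hP)

theorem mem_cocycles {k : ℕ} {P : MultiVec} :
    P ∈ cocycles semiOpenBook k ↔ P ∈ multiVec k ∧ schouten semiOpenBook P = 0 := Iff.rfl

theorem mem_coboundaries_succ {k : ℕ} {P : MultiVec} :
    P ∈ coboundaries semiOpenBook (k + 1) ↔ ∃ Q ∈ multiVec k, schouten semiOpenBook Q = P := Iff.rfl

theorem coboundaries_le_cocycles (k : ℕ) :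
    coboundaries semiOpenBook k ≤ cocycles semiOpenBook k := by
  cases k with
  | zero => exact bot_le
  | succ k =>
    rintro _ ⟨Q, hQ, rfl⟩
    exact ⟨schouten_semiOpenBook_mem hQ, schouten_semiOpenBook_schouten Q⟩

theorem mk_eq_zero_iff {π : MultiVec} {k : ℕ} (x : cocycles π k) :
    (Submodule.Quotient.mk x : PoissonCohomology π k) = 0 ↔ (x : MultiVec) ∈ coboundaries π k :=
  Submodule.Quotient.mk_eq_zero _

theorem cohClass_eq_zero_iff {π : MultiVec} {k : ℕ} {P : MultiVec} (hP : P ∈ cocycles π k) :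
    cohClass π k P hP = 0 ↔ P ∈ coboundaries π k :=
  mk_eq_zero_iff ⟨P, hP⟩

theorem exists_cohClass_eq_zero {k : ℕ} {P : MultiVec} (hP : P ∈ coboundaries semiOpenBook k) :
    ∃ h : P ∈ cocycles semiOpenBook k, cohClass semiOpenBook k P h = 0 :=
  ⟨coboundaries_le_cocycles k hP, (cohClass_eq_zero_iff _).2 hP⟩

/-- The equation `x ∂f/∂z = 0` makes `f` independent of `z`, and `V f = 0` makes it constant along
orbits converging to the axis. -/
theorem casimirs_semiOpenBook : casimirs semiOpenBook = ⊥ := by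
  refine le_antisymm (fun f hf => ?_) bot_le
  have h : schouten semiOpenBook (ofFun f) = 0 := hf
  rw [schouten_semiOpenBook_ofFun, ← mv1_zero] at h
  obtain ⟨h1, -, h3⟩ := mv1_inj h
  rw [eq_algebraMap_of_lieV_eq_zero (neg_eq_zero.1 h3) (eq_zero_of_coord_mul h1)]
  exact Subalgebra.algebraMap_mem _ _

theorem exists_eq_algebraMap_of_casimir (c : casimirs semiOpenBook) :
    ∃ r : ℝ, c = algebraMap ℝ (casimirs semiOpenBook) r := by
  obtain ⟨r, hr⟩ := Algebra.mem_bot.1 (casimirs_semiOpenBook.le c.2)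
  exact ⟨r, Subtype.ext hr.symm⟩

/-- Cocycles whose classes form a basis of the cohomology over the Casimir functions, that is,
over the constants. -/
theorem exists_basis {k n : ℕ} (v : Fin n → MultiVec) (hv : ∀ i, v i ∈ cocycles semiOpenBook k)
    (hli : ∀ r : Fin n → ℝ,
      ∑ i, algebraMap ℝ Smooth (r i) • v i ∈ coboundaries semiOpenBook k → ∀ i, r i = 0)
    (hspan : ∀ P ∈ cocycles semiOpenBook k, ∃ r : Fin n → ℝ,
      P - ∑ i, algebraMap ℝ Smooth (r i) • v i ∈ coboundaries semiOpenBook k) :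
    ∃ b : Module.Basis (Fin n) (casimirs semiOpenBook) (PoissonCohomology semiOpenBook k),
      ∀ i, b i = cohClass semiOpenBook k (v i) (hv i) := by
  have hsum : ∀ r : Fin n → ℝ,
      ∑ i, algebraMap ℝ (casimirs semiOpenBook) (r i) • cohClass semiOpenBook k (v i) (hv i)
        = Submodule.Quotient.mk
          (∑ i, algebraMap ℝ (casimirs semiOpenBook) (r i) •
            (⟨v i, hv i⟩ : cocycles semiOpenBook k)) := by
    intro r
    simp only [← Submodule.mkQ_apply, map_sum, map_smul]
    rfl
  have hcoe : ∀ r : Fin n → ℝ, ((∑ i, algebraMap ℝ (casimirs semiOpenBook) (r i) •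
      (⟨v i, hv i⟩ : cocycles semiOpenBook k) : cocycles semiOpenBook k) : MultiVec)
        = ∑ i, algebraMap ℝ Smooth (r i) • v i := by
    intro r
    rw [AddSubmonoidClass.coe_finsetSum]
    rfl
  refine ⟨Module.Basis.mk (v := fun i => cohClass semiOpenBook k (v i) (hv i)) ?_ ?_,
    fun i => Module.Basis.mk_apply _ _ i⟩
  · rw [Fintype.linearIndependent_iff]
    intro c hc
    choose r hr using fun i => exists_eq_algebraMap_of_casimir (c i)
    simp only [hr] at hc ⊢
    rw [hsum, mk_eq_zero_iff] at hc
    intro i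
    rw [hli r (by rw [← hcoe]; exact hc) i, map_zero]
  · rintro x -
    obtain ⟨⟨P, hP⟩, rfl⟩ := Submodule.Quotient.mk_surjective _ x
    obtain ⟨r, hr⟩ := hspan P hP
    have : Submodule.Quotient.mk ⟨P, hP⟩ = ∑ i, algebraMap ℝ (casimirs semiOpenBook) (r i) •
        cohClass semiOpenBook k (v i) (hv i) := by
      rw [hsum, ← sub_eq_zero, ← Submodule.Quotient.mk_sub, mk_eq_zero_iff, Submodule.coe_sub,
        hcoe]
      exact hr
    rw [this]
    exact Submodule.sum_mem _ fun i _ =>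
      Submodule.smul_mem _ _ (Submodule.subset_span ⟨i, rfl⟩)

/-! ### Cocycles and coboundaries by degree -/

theorem ofFun_one_mem_cocycles : ofFun 1 ∈ cocycles semiOpenBook 0 := by
  refine ⟨ofFun_mem_multiVec 1, ?_⟩
  change schouten semiOpenBook (ofFun 1) = 0
  simp [schouten_semiOpenBook_ofFun, lieV, mv1_zero]

theorem exists_of_mem_cocycles_zero {P : MultiVec} (hP : P ∈ cocycles semiOpenBook 0) :
    ∃ r : ℝ, P = ofFun (algebraMap ℝ Smooth r) := by
  obtain ⟨h0, h⟩ := mem_cocycles.1 hP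
  obtain ⟨f, rfl⟩ := exists_eq_ofFun h0
  obtain ⟨r, hr⟩ := exists_eq_algebraMap_of_casimir ⟨f, h⟩
  exact ⟨r, congrArg ofFun (congrArg Subtype.val hr)⟩

theorem mv1_mem_cocycles (α γ : ℝ) : mv1 0 (algebraMap ℝ Smooth α * coord 0)
    (algebraMap ℝ Smooth γ) ∈ cocycles semiOpenBook 1 := by
  refine mem_cocycles.2 ⟨mv1_mem_multiVec _ _ _, ?_⟩
  rw [schouten_semiOpenBook_mv1, ← mv2_zero]
  congr 1 <;> simp [lieV_mul, pderiv_mul, pderiv_coord]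

theorem mv2_mem_cocycles (β : ℝ) : mv2 0 (algebraMap ℝ Smooth β * coord 1) 0 ∈
    cocycles semiOpenBook 2 := by
  refine mem_cocycles.2 ⟨mv2_mem_multiVec _ _ _, ?_⟩
  rw [schouten_semiOpenBook_mv2, ← mv3_zero]
  congr 1
  simp [pderiv_mul, pderiv_coord]

theorem exists_of_mem_cocycles_one {P : MultiVec} (hP : P ∈ cocycles semiOpenBook 1) :
    ∃ (F : Smooth) (α γ : ℝ), P = schouten semiOpenBook (ofFun F) +
      mv1 0 (algebraMap ℝ Smooth α * coord 0) (algebraMap ℝ Smooth γ) := by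
  obtain ⟨h1, h⟩ := mem_cocycles.1 hP
  obtain ⟨a, b, g, rfl⟩ := exists_eq_mv1 h1
  rw [schouten_semiOpenBook_mv1, ← mv2_zero] at h
  obtain ⟨e1, e2, e3⟩ := mv2_inj h
  obtain ⟨F, α, γ, ha, hb, hg⟩ := exists_of_cocycle_one e1 e2 e3
  refine ⟨F, α, γ, ?_⟩
  rw [schouten_semiOpenBook_ofFun, mv1_add, ← hb, ← hg, add_zero, ← ha]

theorem exists_of_mem_cocycles_two {P : MultiVec} (hP : P ∈ cocycles semiOpenBook 2) :
    ∃ (T : MultiVec) (β : ℝ), T ∈ multiVec 1 ∧ P = schouten semiOpenBook T +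
      mv2 0 (algebraMap ℝ Smooth β * coord 1) 0 := by
  obtain ⟨h1, h⟩ := mem_cocycles.1 hP
  obtain ⟨u, p, q, rfl⟩ := exists_eq_mv2 h1
  rw [schouten_semiOpenBook_mv2, ← mv3_zero] at h
  obtain ⟨a, b, g, β, hu, hp, hq⟩ := exists_of_cocycle_two (mv3_inj h)
  refine ⟨mv1 a b g, β, mv1_mem_multiVec _ _ _, ?_⟩
  rw [schouten_semiOpenBook_mv1, mv2_add, ← hp, add_zero, add_zero, ← hu, ← hq]

theorem multiVec_three_le_coboundaries {P : MultiVec} (hP : P ∈ multiVec 3) :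
    P ∈ coboundaries semiOpenBook 3 := by
  obtain ⟨h, rfl⟩ := exists_eq_mv3 hP
  obtain ⟨u, p, q, rfl⟩ := exists_of_degree_three h
  exact mem_coboundaries_succ.2 ⟨mv2 u p q, mv2_mem_multiVec _ _ _,
    schouten_semiOpenBook_mv2 u p q⟩

theorem multiVec_le_coboundaries {k : ℕ} (hk : 3 ≤ k) {P : MultiVec} (hP : P ∈ multiVec k) :
    P ∈ coboundaries semiOpenBook k := by
  rcases hk.eq_or_lt with rfl | hk
  · exact multiVec_three_le_coboundaries hP
  · rw [eq_zero_of_mem_multiVec hk hP]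
    exact zero_mem _

/-- If the field is `d_π F`, the `∂_x` component gives `∂F/∂z = 0`, so `α x = 0`; and `γ = -V F`
vanishes at the origin. -/
theorem eq_zero_of_mem_coboundaries_one {α γ : ℝ}
    (h : mv1 0 (algebraMap ℝ Smooth α * coord 0) (algebraMap ℝ Smooth γ) ∈
      coboundaries semiOpenBook 1) : α = 0 ∧ γ = 0 := by
  obtain ⟨P, hP, h⟩ := mem_coboundaries_succ.1 h
  obtain ⟨F, rfl⟩ := exists_eq_ofFun hP
  rw [schouten_semiOpenBook_ofFun] at h
  obtain ⟨h1, h2, h3⟩ := mv1_inj h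
  constructor
  · rw [eq_zero_of_coord_mul h1, mul_zero, eq_comm, mul_comm] at h2
    exact congrArg (fun f : Smooth => f 0) (eq_zero_of_coord_mul h2)
  · have := congrArg (fun f : Smooth => f 0) h3
    simpa [lieV_apply_zero] using this.symm

/-- The `y`-derivative at the origin of `V a - a + x ∂g/∂z` is zero for all `a` and `g`. -/
theorem eq_zero_of_mem_coboundaries_two {β : ℝ}
    (h : mv2 0 (algebraMap ℝ Smooth β * coord 1) 0 ∈ coboundaries semiOpenBook 2) : β = 0 := by
  obtain ⟨P, hP, h⟩ := mem_coboundaries_succ.1 h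
  obtain ⟨a, b, g, rfl⟩ := exists_eq_mv1 hP
  rw [schouten_semiOpenBook_mv1] at h
  have := congrArg (fun f => (pderiv 1 f : Smooth) 0) (mv2_inj h).2.1
  simpa [pderiv_one_lieV, pderiv_mul, pderiv_coord, lieV_apply_zero] using this.symm

/-! ### Products and brackets -/

/-- For a cocycle `Q`, Leibniz gives `d_π F ∧ Q = d_π (F Q)`. Applied in both factors, this leaves
the product of the representatives. -/
theorem mul_mem_coboundaries_two {P Q : MultiVec} (hP : P ∈ cocycles semiOpenBook 1)
    (hQ : Q ∈ cocycles semiOpenBook 1) : P * Q ∈ coboundaries semiOpenBook 2 := by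
  obtain ⟨F, α, γ, rfl⟩ := exists_of_mem_cocycles_one hP
  obtain ⟨G, α', γ', hQ'⟩ := exists_of_mem_cocycles_one hQ
  have hF := schouten_smul semiOpenBook F Q
  have hG := schouten_smul semiOpenBook G
    (mv1 0 (algebraMap ℝ Smooth α * coord 0) (algebraMap ℝ Smooth γ))
  rw [(mem_cocycles.1 hQ).2, smul_zero, add_zero] at hF
  rw [(mem_cocycles.1 (mv1_mem_cocycles α γ)).2, smul_zero, add_zero] at hG
  rw [add_mul, ← hF]
  refine add_mem (mem_coboundaries_succ.2
    ⟨_, Submodule.smul_mem _ F (mem_cocycles.1 hQ).1, rfl⟩) ?_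
  -- The product of representatives is a multiple of `x ∂_y ∧ ∂_z = d_π (y ∂_y)`. The exact part of
  -- `Q` contributes `-d_π (G R)`, the sign coming from exchanging two vector fields.
  have hR : mv1 0 (algebraMap ℝ Smooth α * coord 0) (algebraMap ℝ Smooth γ) * Q
      = schouten semiOpenBook (mv1 0 ((algebraMap ℝ Smooth α * algebraMap ℝ Smooth γ'
          - algebraMap ℝ Smooth γ * algebraMap ℝ Smooth α') * coord 1) 0)
        - schouten semiOpenBook
          (G • mv1 0 (algebraMap ℝ Smooth α * coord 0) (algebraMap ℝ Smooth γ)) := by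
    rw [hG, hQ', schouten_semiOpenBook_ofFun, schouten_semiOpenBook_mv1]
    simp only [mv1_mul_mv1, mv1_add, mv2_sub]
    congr 1 <;> simp [lieV_mul, lieV_sub, pderiv_mul, pderiv_coord] <;> ring
  rw [hR]
  exact sub_mem (mem_coboundaries_succ.2 ⟨_, mv1_mem_multiVec _ _ _, rfl⟩)
    (mem_coboundaries_succ.2 ⟨_, Submodule.smul_mem _ G (mv1_mem_multiVec _ _ _), rfl⟩)

theorem schouten_ofFun_mv1 (F a b g : Smooth) : schouten (ofFun F) (mv1 a b g) =
    ofFun (-(a * pderiv 0 F + b * pderiv 1 F + g * pderiv 2 F)) := by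
  simp only [schouten, Fin.sum_univ_three, contractR_ofFun, contractL_mv1, coeffDeriv_ofFun,
    ofFun_mul, zero_mul, Matrix.cons_val]
  simp only [ofFun_eq_smul]
  module

theorem schouten_ofFun_mv2 (F u p q : Smooth) : schouten (ofFun F) (mv2 u p q) =
    mv1 (u * pderiv 1 F + p * pderiv 2 F) (-u * pderiv 0 F + q * pderiv 2 F)
      (-p * pderiv 0 F - q * pderiv 1 F) := by
  simp only [schouten, Fin.sum_univ_three, contractR_ofFun, contractL_mv2, coeffDeriv_ofFun,
    ofFun_mul, zero_mul, smul_mv1, zero_sub, Matrix.cons_val]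
  simp only [mv1]
  module

theorem schouten_mv1_ofFun (F a b g : Smooth) : schouten (mv1 a b g) (ofFun F) =
    ofFun (a * pderiv 0 F + b * pderiv 1 F + g * pderiv 2 F) := by
  simp only [schouten_ofFun, Fin.sum_univ_three, contractR_mv1, ofFun_mul, Matrix.cons_val]
  simp only [ofFun_eq_smul]
  module

/-- The Jacobi identity for `π`, a function and a cocycle of degree one. -/
theorem schouten_schouten_ofFun_one (F : Smooth) {Q : MultiVec}
    (hQ : Q ∈ cocycles semiOpenBook 1) :
    schouten (schouten semiOpenBook (ofFun F)) Q
      = schouten semiOpenBook (schouten (ofFun F) Q) := by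
  obtain ⟨h1, h⟩ := mem_cocycles.1 hQ
  obtain ⟨a, b, g, rfl⟩ := exists_eq_mv1 h1
  rw [schouten_semiOpenBook_mv1, ← mv2_zero] at h
  obtain ⟨e1, e2, e3⟩ := mv2_inj h
  simp only [lieV] at e1 e2 e3
  rw [schouten_ofFun_mv1, schouten_semiOpenBook_ofFun, schouten_semiOpenBook_ofFun,
    schouten_mv1_mv1]
  simp only [lieV, map_add, map_neg, pderiv_mul, pderiv_coord, pderiv_comm 1 0,
    pderiv_comm 2 0, pderiv_comm 2 1, Fin.reduceEq, if_true, if_false]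
  congr 1
  · linear_combination e2 * pderiv 2 F + e1 * pderiv 1 F
  · linear_combination e3 * pderiv 2 F - e1 * pderiv 0 F
  · linear_combination - e2 * pderiv 0 F - e3 * pderiv 1 F

/-- The Jacobi identity for `π`, a function and a cocycle of degree two. -/
theorem schouten_schouten_ofFun_two (F : Smooth) {Q : MultiVec}
    (hQ : Q ∈ cocycles semiOpenBook 2) :
    schouten (schouten semiOpenBook (ofFun F)) Q
      = schouten semiOpenBook (schouten (ofFun F) Q) := by
  obtain ⟨h1, h⟩ := mem_cocycles.1 hQ
  obtain ⟨u, p, q, rfl⟩ := exists_eq_mv2 h1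
  rw [schouten_semiOpenBook_mv2, ← mv3_zero] at h
  have e := mv3_inj h
  simp only [lieV] at e
  rw [schouten_ofFun_mv2, schouten_semiOpenBook_ofFun, schouten_semiOpenBook_mv1,
    schouten_mv1_mv2]
  simp only [lieV, map_add, map_sub, map_neg, pderiv_mul, pderiv_coord, pderiv_comm 1 0,
    pderiv_comm 2 0, pderiv_comm 2 1, Fin.reduceEq, if_true, if_false]
  congr 1
  · linear_combination -e * pderiv 2 F
  · linear_combination e * pderiv 1 F
  · linear_combination -e * pderiv 0 F

/-- The field `α x ∂_y + γ ∂_z` preserves `π`, so by Jacobi its Lie derivative commutes with `d_π`;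
here on functions, next on vector fields. -/
theorem schouten_cocycle_ofFun (α γ : ℝ) (F : Smooth) :
    schouten (mv1 0 (algebraMap ℝ Smooth α * coord 0) (algebraMap ℝ Smooth γ))
      (schouten semiOpenBook (ofFun F)) = schouten semiOpenBook
      (schouten (mv1 0 (algebraMap ℝ Smooth α * coord 0) (algebraMap ℝ Smooth γ)) (ofFun F)) := by
  rw [schouten_mv1_ofFun, schouten_semiOpenBook_ofFun, schouten_semiOpenBook_ofFun,
    schouten_mv1_mv1]
  simp only [lieV, map_add, map_neg, map_zero, pderiv_mul, pderiv_coord, pderiv_comm 1 0,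
    pderiv_comm 2 0, pderiv_comm 2 1, pderiv_algebraMap, Fin.reduceEq, if_true, if_false]
  congr 1 <;> ring

theorem schouten_cocycle_mv1 (α γ : ℝ) (a b g : Smooth) :
    schouten (mv1 0 (algebraMap ℝ Smooth α * coord 0) (algebraMap ℝ Smooth γ))
      (schouten semiOpenBook (mv1 a b g)) = schouten semiOpenBook
      (schouten (mv1 0 (algebraMap ℝ Smooth α * coord 0) (algebraMap ℝ Smooth γ)) (mv1 a b g)) := by
  rw [schouten_mv1_mv1, schouten_semiOpenBook_mv1, schouten_semiOpenBook_mv1, schouten_mv1_mv2]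
  simp only [lieV, map_add, map_sub, map_zero, pderiv_mul, pderiv_coord, pderiv_comm 1 0,
    pderiv_comm 2 0, pderiv_comm 2 1, pderiv_algebraMap, pderiv_one, Fin.reduceEq, if_true, if_false]
  congr 1 <;> ring

theorem schouten_mem_coboundaries_one {P Q : MultiVec} (hP : P ∈ cocycles semiOpenBook 1)
    (hQ : Q ∈ cocycles semiOpenBook 1) : schouten P Q ∈ coboundaries semiOpenBook 1 := by
  obtain ⟨F, α, γ, rfl⟩ := exists_of_mem_cocycles_one hP
  rw [add_schouten, schouten_schouten_ofFun_one F hQ]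
  obtain ⟨G, α', γ', rfl⟩ := exists_of_mem_cocycles_one hQ
  have h0 : schouten (mv1 0 (algebraMap ℝ Smooth α * coord 0) (algebraMap ℝ Smooth γ))
      (mv1 0 (algebraMap ℝ Smooth α' * coord 0) (algebraMap ℝ Smooth γ')) = 0 := by
    rw [schouten_mv1_mv1, ← mv1_zero]
    congr 1 <;> simp [pderiv_mul, pderiv_coord]
  rw [schouten_add (mv1 _ _ _), h0, add_zero, schouten_cocycle_ofFun, ← schouten_add]
  refine mem_coboundaries_succ.2 ⟨_, add_mem ?_ ?_, rfl⟩
  · rw [schouten_semiOpenBook_ofFun, mv1_add, schouten_ofFun_mv1]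
    exact ofFun_mem_multiVec _
  · rw [schouten_mv1_ofFun]
    exact ofFun_mem_multiVec _

theorem schouten_mem_coboundaries_two {P Q : MultiVec} (hP : P ∈ cocycles semiOpenBook 1)
    (hQ : Q ∈ cocycles semiOpenBook 2) : schouten P Q ∈ coboundaries semiOpenBook 2 := by
  obtain ⟨F, α, γ, rfl⟩ := exists_of_mem_cocycles_one hP
  rw [add_schouten, schouten_schouten_ofFun_two F hQ]
  refine add_mem (mem_coboundaries_succ.2 ⟨_, ?_, rfl⟩) ?_
  · obtain ⟨u, p, q, rfl⟩ := exists_eq_mv2 (mem_cocycles.1 hQ).1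
    exact schouten_ofFun_mv2 F u p q ▸ mv1_mem_multiVec _ _ _
  obtain ⟨T, β, hT, rfl⟩ := exists_of_mem_cocycles_two hQ
  obtain ⟨a, b, g, rfl⟩ := exists_eq_mv1 hT
  -- The bracket of `x ∂_y` with `y ∂_x ∧ ∂_z` is `x ∂_x ∧ ∂_z - y ∂_y ∧ ∂_z = d_π (y ∂_x)`, while
  -- `∂_z` contributes nothing.
  have h0 : schouten (mv1 0 (algebraMap ℝ Smooth α * coord 0) (algebraMap ℝ Smooth γ))
      (mv2 0 (algebraMap ℝ Smooth β * coord 1) 0) = schouten semiOpenBook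
        (mv1 (algebraMap ℝ Smooth α * algebraMap ℝ Smooth β * coord 1) 0 0) := by
    rw [schouten_mv1_mv2, schouten_semiOpenBook_mv1]
    congr 1 <;> simp [lieV_mul, pderiv_mul, pderiv_coord] <;> ring
  rw [schouten_add, h0, schouten_cocycle_mv1, ← schouten_add, schouten_mv1_mv1, mv1_add]
  exact mem_coboundaries_succ.2 ⟨_, mv1_mem_multiVec _ _ _, rfl⟩

theorem schouten_ofFun_algebraMap (P : MultiVec) (r : ℝ) :
    schouten P (ofFun (algebraMap ℝ Smooth r)) = 0 := by
  simp [schouten_ofFun, ofFun_zero]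

theorem ofFun_algebraMap_schouten (P : MultiVec) (r : ℝ) :
    schouten (ofFun (algebraMap ℝ Smooth r)) P = 0 := by
  simp [schouten, contractR_ofFun, coeffDeriv_ofFun, ofFun_zero]

theorem mul_mem_coboundaries {p q : ℕ} (hp : 1 ≤ p) (hq : 1 ≤ q) {P Q : MultiVec}
    (hP : P ∈ cocycles semiOpenBook p) (hQ : Q ∈ cocycles semiOpenBook q) :
    P * Q ∈ coboundaries semiOpenBook (p + q) := by
  by_cases h : 3 ≤ p + q
  · exact multiVec_le_coboundaries h
      (mul_mem_multiVec (mem_cocycles.1 hP).1 (mem_cocycles.1 hQ).1)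
  · obtain rfl : p = 1 := by omega
    obtain rfl : q = 1 := by omega
    exact mul_mem_coboundaries_two hP hQ

theorem schouten_mem_coboundaries {p q : ℕ} {P Q : MultiVec}
    (hP : P ∈ cocycles semiOpenBook p) (hQ : Q ∈ cocycles semiOpenBook q) :
    schouten P Q ∈ coboundaries semiOpenBook (p + q - 1) := by
  -- Cocycles of degree zero are constants, whose brackets vanish identically. This covers `p = q =
  -- 0`, where the truncated degree `p + q - 1` is `0` and zero is the only coboundary.
  rcases p with - | p
  · obtain ⟨r, rfl⟩ := exists_of_mem_cocycles_zero hP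
    rw [ofFun_algebraMap_schouten]
    exact zero_mem _
  rcases q with - | q
  · obtain ⟨r, rfl⟩ := exists_of_mem_cocycles_zero hQ
    rw [schouten_ofFun_algebraMap]
    exact zero_mem _
  rw [show p + 1 + (q + 1) - 1 = p + q + 1 by omega]
  by_cases h : 2 ≤ p + q
  · exact multiVec_le_coboundaries (Nat.succ_le_succ h)
      (schouten_mem_multiVec (mem_cocycles.1 hP).1 (mem_cocycles.1 hQ).1)
  obtain ⟨rfl, rfl⟩ | ⟨rfl, rfl⟩ | ⟨rfl, rfl⟩ :
      p = 0 ∧ q = 0 ∨ p = 0 ∧ q = 1 ∨ p = 1 ∧ q = 0 := by omega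
  · exact schouten_mem_coboundaries_one hP hQ
  · exact schouten_mem_coboundaries_two hP hQ
  -- Degrees two and one are exchanged by graded antisymmetry of the bracket.
  · have := schouten_mem_coboundaries_two hQ hP
    obtain ⟨u, p, q, rfl⟩ := exists_eq_mv2 (mem_cocycles.1 hP).1
    obtain ⟨a, b, g, rfl⟩ := exists_eq_mv1 (mem_cocycles.1 hQ).1
    rw [schouten_mv2_mv1]
    exact neg_mem this

theorem algebraMap_smul_ofFun_one (r : ℝ) :
    algebraMap ℝ Smooth r • ofFun 1 = ofFun (algebraMap ℝ Smooth r) := by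
  rw [ofFun_eq_smul, ofFun_eq_smul, one_smul]

theorem smul_del_eq_mv1 (r s : ℝ) :
    algebraMap ℝ Smooth r • (coord 0 • del 1) + algebraMap ℝ Smooth s • del 2
      = mv1 0 (algebraMap ℝ Smooth r * coord 0) (algebraMap ℝ Smooth s) := by
  simp only [mv1]
  module

theorem smul_del_mul_del_eq_mv2 (r : ℝ) :
    algebraMap ℝ Smooth r • (coord 1 • (del 0 * del 2))
      = mv2 0 (algebraMap ℝ Smooth r * coord 1) 0 := by
  simp only [mv2]
  module

end PoissonR3

end

open PoissonR3 in
theorem mainTheorem6 :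
    -- `π` is a Poisson structure, and `d_π` squares to zero
    schouten semiOpenBook semiOpenBook = 0 ∧
    (∀ P : MultiVec, poissonDiff semiOpenBook (poissonDiff semiOpenBook P) = 0) ∧
    -- the Casimir functions are the constants
    casimirs semiOpenBook = ⊥ ∧
    (∃ (h : ofFun 1 ∈ cocycles semiOpenBook 0)
      (b : Module.Basis (Fin 1) (casimirs semiOpenBook) (PoissonCohomology semiOpenBook 0)),
      b 0 = cohClass semiOpenBook 0 (ofFun 1) h) ∧
    -- `H¹` is free over the Casimir functions on the classes of `x ∂_y` and `∂_z`
    (∃ (h₁ : coord 0 • del 1 ∈ cocycles semiOpenBook 1) (h₂ : del 2 ∈ cocycles semiOpenBook 1)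
      (b : Module.Basis (Fin 2) (casimirs semiOpenBook) (PoissonCohomology semiOpenBook 1)),
      b 0 = cohClass semiOpenBook 1 (coord 0 • del 1) h₁ ∧
      b 1 = cohClass semiOpenBook 1 (del 2) h₂) ∧
    -- `H²` is free over the Casimir functions on the class of `y ∂_x ∧ ∂_z`
    (∃ (h : coord 1 • (del 0 * del 2) ∈ cocycles semiOpenBook 2)
      (b : Module.Basis (Fin 1) (casimirs semiOpenBook) (PoissonCohomology semiOpenBook 2)),
      b 0 = cohClass semiOpenBook 2 (coord 1 • (del 0 * del 2)) h) ∧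
    -- `H³ = 0`
    Subsingleton (PoissonCohomology semiOpenBook 3) ∧
    -- the wedge product of two classes of positive degree is zero
    (∀ (p q : ℕ) (P Q : MultiVec), 1 ≤ p → 1 ≤ q →
      P ∈ cocycles semiOpenBook p → Q ∈ cocycles semiOpenBook q →
      ∃ h : P * Q ∈ cocycles semiOpenBook (p + q),
        cohClass semiOpenBook (p + q) (P * Q) h = 0) ∧
    -- the Schouten–Nijenhuis bracket of any two classes is zero
    (∀ (p q : ℕ) (P Q : MultiVec),
      P ∈ cocycles semiOpenBook p → Q ∈ cocycles semiOpenBook q →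
      ∃ h : schouten P Q ∈ cocycles semiOpenBook (p + q - 1),
        cohClass semiOpenBook (p + q - 1) (schouten P Q) h = 0) := by
  refine ⟨schouten_semiOpenBook_self, schouten_semiOpenBook_schouten, casimirs_semiOpenBook,
    ?_, ?_, ?_, ?_, fun p q P Q hp hq hP hQ =>
      exists_cohClass_eq_zero (mul_mem_coboundaries hp hq hP hQ),
    fun p q P Q hP hQ => exists_cohClass_eq_zero (schouten_mem_coboundaries hP hQ)⟩
  · obtain ⟨b, hb⟩ := exists_basis (k := 0) ![ofFun 1]
      (fun i => by fin_cases i; exact ofFun_one_mem_cocycles)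
      (fun r hr i => by
        rw [Fin.sum_univ_one, coboundaries, Submodule.mem_bot] at hr
        rw [Subsingleton.elim i 0]
        exact congrArg (fun f : Smooth => f 0)
          (ofFun_injective ((algebraMap_smul_ofFun_one (r 0)).symm.trans (hr.trans ofFun_zero.symm))))
      (fun P hP => by
        obtain ⟨r, rfl⟩ := exists_of_mem_cocycles_zero hP
        refine ⟨![r], ?_⟩
        rw [Fin.sum_univ_one, ← algebraMap_smul_ofFun_one]
        simp)
    exact ⟨ofFun_one_mem_cocycles, b, hb 0⟩
  · have h₁ : coord 0 • del 1 ∈ cocycles semiOpenBook 1 := by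
      have := mv1_mem_cocycles 1 0
      rw [← smul_del_eq_mv1] at this
      simpa using this
    have h₂ : del 2 ∈ cocycles semiOpenBook 1 := by
      have := mv1_mem_cocycles 0 1
      rw [← smul_del_eq_mv1] at this
      simpa using this
    obtain ⟨b, hb⟩ := exists_basis (k := 1) ![coord 0 • del 1, del 2]
      (fun i => by fin_cases i; exacts [h₁, h₂])
      (fun r hr => by
        rw [Fin.sum_univ_two] at hr
        have := eq_zero_of_mem_coboundaries_one (smul_del_eq_mv1 (r 0) (r 1) ▸ hr)
        intro i
        fin_cases i
        exacts [this.1, this.2])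
      (fun P hP => by
        obtain ⟨F, α, γ, rfl⟩ := exists_of_mem_cocycles_one hP
        refine ⟨![α, γ], ?_⟩
        rw [Fin.sum_univ_two, ← smul_del_eq_mv1]
        have := mem_coboundaries_succ.2 ⟨_, ofFun_mem_multiVec F, rfl⟩
        simpa using this)
    exact ⟨h₁, h₂, b, hb 0, hb 1⟩
  · have h : coord 1 • (del 0 * del 2) ∈ cocycles semiOpenBook 2 := by
      have := mv2_mem_cocycles 1
      rw [← smul_del_mul_del_eq_mv2] at this
      simpa using this
    obtain ⟨b, hb⟩ := exists_basis (k := 2) ![coord 1 • (del 0 * del 2)]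
      (fun i => by fin_cases i; exact h)
      (fun r hr i => by
        rw [Fin.sum_univ_one] at hr
        rw [Subsingleton.elim i 0]
        exact eq_zero_of_mem_coboundaries_two (smul_del_mul_del_eq_mv2 (r 0) ▸ hr))
      (fun P hP => by
        obtain ⟨T, β, hT, rfl⟩ := exists_of_mem_cocycles_two hP
        refine ⟨![β], ?_⟩
        rw [Fin.sum_univ_one, ← smul_del_mul_del_eq_mv2]
        have := mem_coboundaries_succ.2 ⟨_, hT, rfl⟩
        simpa using this)
    exact ⟨h, b, hb 0⟩
  · refine subsingleton_of_forall_eq 0 fun x => ?_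
    obtain ⟨⟨P, hP⟩, rfl⟩ := Submodule.Quotient.mk_surjective _ x
    exact (cohClass_eq_zero_iff hP).2 (multiVec_le_coboundaries le_rfl (mem_cocycles.1 hP).1)
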